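/- Let $(\widetilde M,g)$ be a $(2m+2)$-dimensional metric $f$-manifold with two structure vector fields: a Riemannian manifold with a $(1,1)$-tensor field $f$ of rank $2m$ satisfying $f^3+f=0$, and vector fields $\xi_1,\xi_2$ with dual 1-forms $\eta_1,\eta_2$ (so $\eta_\alpha(\xi_\beta)=\delta_{\alpha\beta}$) such that $f\xi_\alpha=0$, $\eta_\alpha\circ f=0$, $f^2=-I+\sum_{\alpha}\eta_\alpha\otimes\xi_\alpha$ and $g(X,Y)=g(fX,fY)+\sum_\alpha\eta_\alpha(X)\eta_\alpha(Y)$. Suppose that $\widetilde M$ is a generalized $S$-space-form, i.e. there are differentiable functions $F_1,F_2,F_3,F_{11},F_{12},F_{21},F_{22}$ on $\widetilde M$ such that its curvature tensor is $\widetilde R=\sum_{i=1}^3F_i\widetilde R_i+\sum_{i,j=1}^2F_{ij}\widetilde R_{ij}$, where $$\begin{aligned} \widetilde R_1(X,Y)Z&=g(Y,Z)X-g(X,Z)Y,\\ \widetilde R_2(X,Y)Z&=g(X,fZ)fY-g(Y,fZ)fX+2g(X,fY)fZ,\\ \widetilde R_3(X,Y)Z&=\eta_1(X)\eta_2(Y)\eta_2(Z)\xi_1-\eta_2(X)\eta_1(Y)\eta_2(Z)\xi_1+\eta_2(X)\eta_1(Y)\eta_1(Z)\xi_2-\eta_1(X)\eta_2(Y)\eta_1(Z)\xi_2,\\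 \widetilde R_{ij}(X,Y)Z&=\eta_i(X)\eta_j(Z)Y-\eta_i(Y)\eta_j(Z)X+g(X,Z)\eta_i(Y)\xi_j-g(Y,Z)\eta_i(X)\xi_j . \end{aligned}$$ Let $M$ be an $(n+2)$-dimensional Riemannian manifold isometrically immersed in $\widetilde M$, such that $\xi_1,\xi_2$ are tangent to $M$. Let $\sigma$ be its second fundamental form, $A_V$ the shape operator of a normal vector $V$ (so $g(A_VX,Y)=g(\sigma(X,Y),V)$), and $H=\frac1{n+2}\sum_{i=1}^{n+2}\sigma(e_i,e_i)$ its mean curvature vector ($e_1,\dots,e_{n+2}$ any orthonormal basis of $T_pM$). Let $K$ be the sectional curvature of $M$ and $\tau=\frac12\sum_{i\ne j}K(e_i\wedge e_j)$ its scalar curvature. Let $\mathcal L_p\subset T_pM$ be the orthogonal complement of the span of $(\xi_1)_p,(\xi_2)_p$, let $TX$ be the tangential part of $fX$ for $X\in T_pM$, and put $\|T\|^2=\sum_{i,j=1}^n g(e_i,Te_j)^2$ for any orthonormal basis $e_1,\dots,e_n$ of $\mathcal L_p$. For a plane $\pi\subset\mathcal L_p$ with orthonormal basis $\{e_1,e_2\}$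 put $F^2(\pi)=g(e_1,fe_2)^2$. Then for every point $p\in M$ and every plane $\pi\subset\mathcal L_p$, we have at $p$ $$\tau-K(\pi)\le\frac{n(n+2)^2}{2(n+1)}\|H\|^2+\frac{n(n+3)}2F_1+F_3-(n+1)(F_{11}+F_{22})+3F_2\left(\frac{\|T\|^2}2-F^2(\pi)\right).$$ Moreover, equality holds for $p$ and $\pi$ if and only if there exist orthonormal bases $\{e_1,\dots,e_{n+2}\}$ of $T_pM$ and $\{e_{n+3},\dots,e_{2m+2}\}$ of $T_p^\perp M$ such that (i) $e_{n+1}=(\xi_1)_p$ and $e_{n+2}=(\xi_2)_p$; (ii) $\pi$ is spanned by $e_1$ and $e_2$; (iii) in the basis $\{e_1,\dots,e_{n+2}\}$ the shape operators $A_r=A_{e_r}$, $r=n+3,\dots,2m+2$, have the matrices $$A_{n+3}=\begin{pmatrix}a&b&0&\cdots&0\\ b&c-a&0&\cdots&0\\ 0&0&c&\cdots&0\\ \vdots&\vdots&\vdots&\ddots&\vdots\\ 0&0&0&\cdots&c\end{pmatrix},\qquad A_r=\begin{pmatrix}a_r&b_r&0\\ b_r&-a_r&0\\ 0&0&0\end{pmatrix}\quad(r\ge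 n+4),$$ for some real numbers $a,b,c$ and $a_r,b_r$, $r=n+4,\dots,2m+2$. (If $n=2m$ there are no normal directions and (iii) is void.) -/

import Mathlib

noncomputable section

namespace SSpaceForm

/-! ## Coordinate formulas for a metric on a vector space -/

section Coordinates

variable {E E' : Type*} [NormedAddCommGroup E] [NormedSpace ℝ E]
  [NormedAddCommGroup E'] [NormedSpace ℝ E']

set_option maxSynthPendingDepth 3 in
/-- The Christoffel symbols of the first kind of a field `G` of bilinear forms on `E`:
`(u, v, w) ↦ (D_u G (v, w) + D_v G (u, w) - D_w G (u, v)) / 2`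
(see `christoffelFirst_apply`). -/
def christoffelFirst (G : E → E →L[ℝ] E →L[ℝ] ℝ) (y : E) : E →L[ℝ] E →L[ℝ] E →L[ℝ] ℝ :=
  let D : E →L[ℝ] E →L[ℝ] E →L[ℝ] ℝ := fderiv ℝ G y
  let flip : (E →L[ℝ] E →L[ℝ] ℝ) →L[ℝ] (E →L[ℝ] E →L[ℝ] ℝ) :=
    (ContinuousLinearMap.flipₗᵢ ℝ E E ℝ).toContinuousLinearEquiv
  (1 / 2 : ℝ) • (D + D.flip - flip.comp D.flip)

set_option maxSynthPendingDepth 3 in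
theorem christoffelFirst_apply (G : E → E →L[ℝ] E →L[ℝ] ℝ) (y u v w : E) :
    christoffelFirst G y u v w =
      (1 / 2 : ℝ) * (fderiv ℝ G y u v w + fderiv ℝ G y v u w - fderiv ℝ G y w u v) := by
  simp [christoffelFirst]

/-- The Christoffel symbols (of the second kind) of `G`: for nondegenerate `G y`, the vector
`christoffel G y u v` is the one with `G y (christoffel G y u v) w = christoffelFirst G y u v w`
for all `w`, that is, the Levi-Civita derivative at `y` of the constant field `v` along `u`. -/
def christoffel (G : E → E →L[ℝ] E →L[ℝ] ℝ) (y : E) : E →L[ℝ] E →L[ℝ] E :=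
  (ContinuousLinearMap.compL ℝ E (E →L[ℝ] ℝ) E (G y).inverse).comp (christoffelFirst G y)

theorem christoffel_apply (G : E → E →L[ℝ] E →L[ℝ] ℝ) (y u v : E) :
    christoffel G y u v = (G y).inverse (christoffelFirst G y u v) := rfl

/-- The Riemann curvature tensor `R(u, v)w = ∇_u ∇_v w - ∇_v ∇_u w` of the metric `G` at `y`,
for constant fields `u, v, w`. -/
def coordCurvature (G : E → E →L[ℝ] E →L[ℝ] ℝ) (y u v w : E) : E :=
  fderiv ℝ (christoffel G) y u v w - fderiv ℝ (christoffel G) y v u w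
    + christoffel G y u (christoffel G y v w) - christoffel G y v (christoffel G y u w)

/-- The second fundamental form at `y` of a map `h : E → E'`, where `E` carries the metric `G` and
`E'` the metric `G'`, by the Gauss formula
`σ(u, v) = ∇'_u (Dh v) - Dh (∇_u v)` for constant fields `u, v`. -/
def coordSecondFundamentalForm (G : E → E →L[ℝ] E →L[ℝ] ℝ) (G' : E' → E' →L[ℝ] E' →L[ℝ] ℝ)
    (h : E → E') (y : E) : E →L[ℝ] E →L[ℝ] E' :=
  fderiv ℝ (fderiv ℝ h) y
    + (christoffel G' (h y)).bilinearComp (fderiv ℝ h y) (fderiv ℝ h y)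
    - (ContinuousLinearMap.compL ℝ E E E' (fderiv ℝ h y)).comp (christoffel G y)

theorem coordSecondFundamentalForm_apply (G : E → E →L[ℝ] E →L[ℝ] ℝ)
    (G' : E' → E' →L[ℝ] E' →L[ℝ] ℝ) (h : E → E') (y u v : E) :
    coordSecondFundamentalForm G G' h y u v =
      fderiv ℝ (fderiv ℝ h) y u v + christoffel G' (h y) (fderiv ℝ h y u) (fderiv ℝ h y v)
        - fderiv ℝ h y (christoffel G y u v) := rfl

end Coordinates

end SSpaceForm

end

open Bundle
open scoped Manifold ContDiff Bundle

noncomputable section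

namespace SSpaceForm

/-! ## Riemannian manifolds -/

instance instFiniteDimensionalTangentSpace {d : ℕ} {M : Type*} [TopologicalSpace M]
    [ChartedSpace (EuclideanSpace ℝ (Fin d)) M] (x : M) :
    FiniteDimensional ℝ (TangentSpace (𝓡 d) x) :=
  inferInstanceAs (FiniteDimensional ℝ (EuclideanSpace ℝ (Fin d)))

section Riemannian

variable {d : ℕ} {M : Type*} [TopologicalSpace M] [ChartedSpace (EuclideanSpace ℝ (Fin d)) M]
  [IsManifold (𝓡 d) ∞ M] [RiemannianBundle (fun x : M ↦ TangentSpace (𝓡 d) x)]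

/-- The metric of `M` in the preferred chart at `x`. The map
`(trivializationAt _ _ x).symmL ℝ q` sends `u` to the value at `q` of the coordinate vector field
of that chart with constant components `u`; it is the derivative of the inverse chart. -/
def metricInChart (x : M) (y : EuclideanSpace ℝ (Fin d)) :
    EuclideanSpace ℝ (Fin d) →L[ℝ] EuclideanSpace ℝ (Fin d) →L[ℝ] ℝ :=
  let q : M := (extChartAt (𝓡 d) x).symm y
  let A : EuclideanSpace ℝ (Fin d) →L[ℝ] TangentSpace (𝓡 d) q :=
    (trivializationAt (EuclideanSpace ℝ (Fin d)) (TangentSpace (𝓡 d) (M := M)) x).symmL ℝ q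
  (innerSL ℝ (E := TangentSpace (𝓡 d) q)).bilinearComp A A

theorem metricInChart_apply (x : M) (y u v : EuclideanSpace ℝ (Fin d)) :
    metricInChart x y u v = inner ℝ
      ((trivializationAt (EuclideanSpace ℝ (Fin d)) (TangentSpace (𝓡 d) (M := M)) x).symmL ℝ
        ((extChartAt (𝓡 d) x).symm y) u)
      ((trivializationAt (EuclideanSpace ℝ (Fin d)) (TangentSpace (𝓡 d) (M := M)) x).symmL ℝ
        ((extChartAt (𝓡 d) x).symm y) v) := rfl

/-- The Riemann curvature tensor of `M` at `x`, computed in the preferred chart at `x` (the chart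
through which `TangentSpace (𝓡 d) x` is identified with the model space). -/
def curvature (x : M) (X Y Z : TangentSpace (𝓡 d) x) : TangentSpace (𝓡 d) x :=
  coordCurvature (metricInChart x) (extChartAt (𝓡 d) x x) X Y Z

/-- The sectional curvature `K(X ∧ Y)` of the plane spanned by `X` and `Y`. -/
def sectionalCurvature (x : M) (X Y : TangentSpace (𝓡 d) x) : ℝ :=
  inner ℝ (curvature x X Y Y) X / (‖X‖ ^ 2 * ‖Y‖ ^ 2 - inner ℝ X Y ^ 2)

/-- An orthonormal basis of a plane section. -/
def planeBasis {x : M} (P : Submodule ℝ (TangentSpace (𝓡 d) x))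
    (hP : Module.finrank ℝ P = 2) : OrthonormalBasis (Fin 2) ℝ P :=
  (stdOrthonormalBasis ℝ P).reindex (finCongr hP)

/-- The sectional curvature `K(P)` of a plane section `P`. -/
def planeCurvature {x : M} (P : Submodule ℝ (TangentSpace (𝓡 d) x))
    (hP : Module.finrank ℝ P = 2) : ℝ :=
  sectionalCurvature x (planeBasis P hP 0 : TangentSpace (𝓡 d) x) (planeBasis P hP 1)

variable (d) in
/-- The scalar curvature `τ = (1/2) ∑_{i ≠ j} K(e_i ∧ e_j)`, for an orthonormal basis `e` of the
tangent space. -/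
def scalarCurvature (x : M) : ℝ :=
  (1 / 2) * ∑ i, ∑ j ∈ Finset.univ.erase i,
    sectionalCurvature x (stdOrthonormalBasis ℝ (TangentSpace (𝓡 d) x) i)
      (stdOrthonormalBasis ℝ (TangentSpace (𝓡 d) x) j)

end Riemannian

/-! ## Isometric immersions -/

section Immersion

variable {d k : ℕ}
  {M : Type*} [TopologicalSpace M] [ChartedSpace (EuclideanSpace ℝ (Fin d)) M]
  [IsManifold (𝓡 d) ∞ M] [RiemannianBundle (fun x : M ↦ TangentSpace (𝓡 d) x)]
  {N : Type*} [TopologicalSpace N] [ChartedSpace (EuclideanSpace ℝ (Fin k)) N]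
  [IsManifold (𝓡 k) ∞ N] [RiemannianBundle (fun x : N ↦ TangentSpace (𝓡 k) x)]

variable (d k) in
/-- A smooth map whose differential preserves the metrics (in particular, an immersion). -/
structure IsIsometricImmersion (ι : M → N) : Prop where
  contMDiff : ContMDiff (𝓡 d) (𝓡 k) ∞ ι
  inner_mfderiv : ∀ (p : M) (X Y : TangentSpace (𝓡 d) p),
    inner ℝ (mfderiv (𝓡 d) (𝓡 k) ι p X) (mfderiv (𝓡 d) (𝓡 k) ι p Y) = inner ℝ X Y

variable (d k) in
/-- The normal space of `ι` at `p`. -/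
def normalSpace (ι : M → N) (p : M) : Submodule ℝ (TangentSpace (𝓡 k) (ι p)) :=
  (LinearMap.range (mfderiv (𝓡 d) (𝓡 k) ι p : TangentSpace (𝓡 d) p →ₗ[ℝ] _))ᗮ

variable (d k) in
/-- The second fundamental form `σ` of `ι` at `p`. -/
def secondFundamentalForm (ι : M → N) (p : M) :
    TangentSpace (𝓡 d) p →L[ℝ] TangentSpace (𝓡 d) p →L[ℝ] TangentSpace (𝓡 k) (ι p) :=
  let σ : EuclideanSpace ℝ (Fin d) →L[ℝ] EuclideanSpace ℝ (Fin d) →L[ℝ]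
      EuclideanSpace ℝ (Fin k) :=
    coordSecondFundamentalForm (metricInChart p) (metricInChart (ι p))
      (writtenInExtChartAt (𝓡 d) (𝓡 k) p ι) (extChartAt (𝓡 d) p p)
  σ

variable (d k) in
/-- The mean curvature vector `H = (1 / dim M) ∑ i, σ(e_i, e_i)`, for an orthonormal basis `e` of
the tangent space. -/
def meanCurvature (ι : M → N) (p : M) : TangentSpace (𝓡 k) (ι p) :=
  (1 / (d : ℝ)) • ∑ i, secondFundamentalForm d k ι p
    (stdOrthonormalBasis ℝ (TangentSpace (𝓡 d) p) i)
    (stdOrthonormalBasis ℝ (TangentSpace (𝓡 d) p) i)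

variable (d k) in
/-- The shape operator `A_V`, determined by `g(A_V X, Y) = g(σ(X, Y), V)`. -/
def shapeOperator (ι : M → N) (p : M) (V : TangentSpace (𝓡 k) (ι p)) :
    TangentSpace (𝓡 d) p →ₗ[ℝ] TangentSpace (𝓡 d) p where
  toFun X := LinearMap.adjoint
    (secondFundamentalForm d k ι p X : TangentSpace (𝓡 d) p →ₗ[ℝ] TangentSpace (𝓡 k) (ι p)) V
  map_add' X Y := by simp
  map_smul' c X := by simp

theorem inner_shapeOperator (ι : M → N) (p : M) (V : TangentSpace (𝓡 k) (ι p))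
    (X Y : TangentSpace (𝓡 d) p) :
    inner ℝ (shapeOperator d k ι p V X) Y = inner ℝ (secondFundamentalForm d k ι p X Y) V := by
  rw [real_inner_comm V]
  exact LinearMap.adjoint_inner_left
    (secondFundamentalForm d k ι p X : TangentSpace (𝓡 d) p →ₗ[ℝ] TangentSpace (𝓡 k) (ι p)) Y V

end Immersion

/-! ## Metric `f`-manifolds and generalized `S`-space-forms -/

/-- A metric `f`-structure with `s` structure vector fields on a Riemannian manifold `N` of
dimension `2m + s`. -/
structure MetricFStructure (m s : ℕ) (N : Type*) [TopologicalSpace N]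
    [ChartedSpace (EuclideanSpace ℝ (Fin (2 * m + s))) N] [IsManifold (𝓡 (2 * m + s)) ∞ N]
    [RiemannianBundle (fun x : N ↦ TangentSpace (𝓡 (2 * m + s)) x)] where
  /-- the `f`-structure -/
  f : ∀ x : N, TangentSpace (𝓡 (2 * m + s)) x →L[ℝ] TangentSpace (𝓡 (2 * m + s)) x
  /-- the structure vector fields -/
  ξ : Fin s → ∀ x : N, TangentSpace (𝓡 (2 * m + s)) x
  /-- the dual one-forms of the structure vector fields -/
  η : Fin s → ∀ x : N, TangentSpace (𝓡 (2 * m + s)) x →L[ℝ] ℝ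
  contMDiff_f : ContMDiff (𝓡 (2 * m + s)) ((𝓡 (2 * m + s)).prod
    𝓘(ℝ, EuclideanSpace ℝ (Fin (2 * m + s)) →L[ℝ] EuclideanSpace ℝ (Fin (2 * m + s)))) ∞
    (fun x ↦ TotalSpace.mk' (EuclideanSpace ℝ (Fin (2 * m + s)) →L[ℝ]
      EuclideanSpace ℝ (Fin (2 * m + s))) x (f x))
  contMDiff_ξ : ∀ α, ContMDiff (𝓡 (2 * m + s)) (𝓡 (2 * m + s)).tangent ∞
    (fun x ↦ (⟨x, ξ α x⟩ : TangentBundle (𝓡 (2 * m + s)) N))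
  contMDiff_η : ∀ α, ContMDiff (𝓡 (2 * m + s)) ((𝓡 (2 * m + s)).prod
    𝓘(ℝ, EuclideanSpace ℝ (Fin (2 * m + s)) →L[ℝ] ℝ)) ∞
    (fun x ↦ TotalSpace.mk' (EuclideanSpace ℝ (Fin (2 * m + s)) →L[ℝ] ℝ)
      (E := fun x : N ↦ TangentSpace (𝓡 (2 * m + s)) x →L[ℝ] Bundle.Trivial N ℝ x) x (η α x))
  rank_f : ∀ x, Module.finrank ℝ (LinearMap.range
    (f x : TangentSpace (𝓡 (2 * m + s)) x →ₗ[ℝ] TangentSpace (𝓡 (2 * m + s)) x)) = 2 * m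
  f_cube : ∀ x X, f x (f x (f x X)) + f x X = 0
  η_ξ : ∀ α β x, η α x (ξ β x) = if α = β then 1 else 0
  f_ξ : ∀ α x, f x (ξ α x) = 0
  η_f : ∀ α x X, η α x (f x X) = 0
  f_sq : ∀ x X, f x (f x X) = -X + ∑ α, η α x X • ξ α x
  inner_eq : ∀ x X Y, inner ℝ X Y = inner ℝ (f x X) (f x Y) + ∑ α, η α x X * η α x Y

section SpaceForm

variable {m : ℕ} {N : Type*} [TopologicalSpace N]
  [ChartedSpace (EuclideanSpace ℝ (Fin (2 * m + 2))) N] [IsManifold (𝓡 (2 * m + 2)) ∞ N]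
  [RiemannianBundle (fun x : N ↦ TangentSpace (𝓡 (2 * m + 2)) x)]

/-- `R₁(X, Y)Z`. -/
def tensorR₁ (x : N) (X Y Z : TangentSpace (𝓡 (2 * m + 2)) x) : TangentSpace (𝓡 (2 * m + 2)) x :=
  inner ℝ Y Z • X - inner ℝ X Z • Y

namespace MetricFStructure

variable (S : MetricFStructure m 2 N)

/-- `R₂(X, Y)Z`. -/
def tensorR₂ (x : N) (X Y Z : TangentSpace (𝓡 (2 * m + 2)) x) : TangentSpace (𝓡 (2 * m + 2)) x :=
  inner ℝ X (S.f x Z) • S.f x Y - inner ℝ Y (S.f x Z) • S.f x X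
    + (2 * inner ℝ X (S.f x Y)) • S.f x Z

/-- `R₃(X, Y)Z`; the first structure vector field has index `0`, the second has index `1`. -/
def tensorR₃ (x : N) (X Y Z : TangentSpace (𝓡 (2 * m + 2)) x) : TangentSpace (𝓡 (2 * m + 2)) x :=
  (S.η 0 x X * S.η 1 x Y * S.η 1 x Z) • S.ξ 0 x - (S.η 1 x X * S.η 0 x Y * S.η 1 x Z) • S.ξ 0 x
    + (S.η 1 x X * S.η 0 x Y * S.η 0 x Z) • S.ξ 1 x
    - (S.η 0 x X * S.η 1 x Y * S.η 0 x Z) • S.ξ 1 x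

/-- `R_{ij}(X, Y)Z`. -/
def tensorRij (i j : Fin 2) (x : N) (X Y Z : TangentSpace (𝓡 (2 * m + 2)) x) :
    TangentSpace (𝓡 (2 * m + 2)) x :=
  (S.η i x X * S.η j x Z) • Y - (S.η i x Y * S.η j x Z) • X
    + (inner ℝ X Z * S.η i x Y) • S.ξ j x - (inner ℝ Y Z * S.η i x X) • S.ξ j x

/-- `N` is a generalized `S`-space-form (with two structure vector fields) with the functions
`F₁, F₂, F₃, F₁₁, F₁₂, F₂₁, F₂₂`. -/
structure IsGeneralizedSSpaceForm (F₁ F₂ F₃ F₁₁ F₁₂ F₂₁ F₂₂ : N → ℝ) : Prop where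
  mdifferentiable₁ : MDifferentiable (𝓡 (2 * m + 2)) 𝓘(ℝ, ℝ) F₁
  mdifferentiable₂ : MDifferentiable (𝓡 (2 * m + 2)) 𝓘(ℝ, ℝ) F₂
  mdifferentiable₃ : MDifferentiable (𝓡 (2 * m + 2)) 𝓘(ℝ, ℝ) F₃
  mdifferentiable₁₁ : MDifferentiable (𝓡 (2 * m + 2)) 𝓘(ℝ, ℝ) F₁₁
  mdifferentiable₁₂ : MDifferentiable (𝓡 (2 * m + 2)) 𝓘(ℝ, ℝ) F₁₂
  mdifferentiable₂₁ : MDifferentiable (𝓡 (2 * m + 2)) 𝓘(ℝ, ℝ) F₂₁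
  mdifferentiable₂₂ : MDifferentiable (𝓡 (2 * m + 2)) 𝓘(ℝ, ℝ) F₂₂
  curvature_eq : ∀ (x : N) (X Y Z : TangentSpace (𝓡 (2 * m + 2)) x),
    curvature x X Y Z =
      F₁ x • tensorR₁ x X Y Z + F₂ x • S.tensorR₂ x X Y Z + F₃ x • S.tensorR₃ x X Y Z
        + F₁₁ x • S.tensorRij 0 0 x X Y Z + F₁₂ x • S.tensorRij 0 1 x X Y Z
        + F₂₁ x • S.tensorRij 1 0 x X Y Z + F₂₂ x • S.tensorRij 1 1 x X Y Z

variable {n : ℕ} {M : Type*} [TopologicalSpace M]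
  [ChartedSpace (EuclideanSpace ℝ (Fin (n + 2))) M] [IsManifold (𝓡 (n + 2)) ∞ M]
  [RiemannianBundle (fun x : M ↦ TangentSpace (𝓡 (n + 2)) x)]

variable (n) in
/-- The structure vector fields are tangent to `M` along `ι`. -/
def IsTangent (ι : M → N) : Prop :=
  ∀ (p : M) (α : Fin 2), S.ξ α (ι p) ∈ LinearMap.range
    (mfderiv (𝓡 (n + 2)) (𝓡 (2 * m + 2)) ι p : TangentSpace (𝓡 (n + 2)) p →ₗ[ℝ] _)

variable (n) in
/-- The subspace `𝓛_p` of the tangent vectors of `M` orthogonal to the structure vector fields. -/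
def distL (ι : M → N) (p : M) : Submodule ℝ (TangentSpace (𝓡 (n + 2)) p) :=
  (Submodule.span ℝ (Set.range fun α ↦ S.ξ α (ι p)))ᗮ.comap
    (mfderiv (𝓡 (n + 2)) (𝓡 (2 * m + 2)) ι p : TangentSpace (𝓡 (n + 2)) p →ₗ[ℝ] _)

variable (n) in
/-- The tangential part `T` of `f` along `ι`: `g(T X, Y) = g(f X, Y)` for `X, Y` tangent to `M`. -/
def tangentialPart (ι : M → N) (p : M) :
    TangentSpace (𝓡 (n + 2)) p →ₗ[ℝ] TangentSpace (𝓡 (n + 2)) p :=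
  LinearMap.adjoint
      (mfderiv (𝓡 (n + 2)) (𝓡 (2 * m + 2)) ι p : TangentSpace (𝓡 (n + 2)) p →ₗ[ℝ] _) ∘ₗ
    (S.f (ι p) : TangentSpace (𝓡 (2 * m + 2)) (ι p) →ₗ[ℝ] TangentSpace (𝓡 (2 * m + 2)) (ι p)) ∘ₗ
    (mfderiv (𝓡 (n + 2)) (𝓡 (2 * m + 2)) ι p : TangentSpace (𝓡 (n + 2)) p →ₗ[ℝ] _)

variable (n) in
/-- `‖T‖² = ∑ i j, g(e_i, T e_j)²`, for an orthonormal basis `e` of `𝓛_p`. -/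
def normSqT (ι : M → N) (p : M) : ℝ :=
  ∑ i, ∑ j, inner ℝ (stdOrthonormalBasis ℝ (S.distL n ι p) i : TangentSpace (𝓡 (n + 2)) p)
    (S.tangentialPart n ι p (stdOrthonormalBasis ℝ (S.distL n ι p) j)) ^ 2

/-- `F²(P) = g(e₁, f e₂)²`, for an orthonormal basis `e₁, e₂` of the plane `P`. -/
def planeFSq (ι : M → N) {p : M} (P : Submodule ℝ (TangentSpace (𝓡 (n + 2)) p))
    (hP : Module.finrank ℝ P = 2) : ℝ :=
  inner ℝ (mfderiv (𝓡 (n + 2)) (𝓡 (2 * m + 2)) ι p (planeBasis P hP 0))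
    (S.f (ι p) (mfderiv (𝓡 (n + 2)) (𝓡 (2 * m + 2)) ι p (planeBasis P hP 1))) ^ 2

end MetricFStructure

end SpaceForm

/-- The block matrix with upper left block `(a, b; b, c - a)` followed by the diagonal entries
`c, …, c`. -/
def firstShapeMatrix (k : ℕ) (a b c : ℝ) : Matrix (Fin k) (Fin k) ℝ :=
  Matrix.of fun i j ↦
    if i.val = 0 ∧ j.val = 0 then a
    else if i.val = 1 ∧ j.val = 1 then c - a
    else if i.val = 0 ∧ j.val = 1 ∨ i.val = 1 ∧ j.val = 0 then b
    else if i = j then c else 0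

/-- The block matrix with upper left block `(a, b; b, -a)` and all other entries zero. -/
def otherShapeMatrix (k : ℕ) (a b : ℝ) : Matrix (Fin k) (Fin k) ℝ :=
  Matrix.of fun i j ↦
    if i.val = 0 ∧ j.val = 0 then a
    else if i.val = 1 ∧ j.val = 1 then -a
    else if i.val = 0 ∧ j.val = 1 ∨ i.val = 1 ∧ j.val = 0 then b
    else 0

end SSpaceForm

end

noncomputable section

namespace SSpaceForm

/-! ## The Gauss equation in coordinates -/

section CoordinateGauss

set_option synthInstance.maxHeartbeats 200000
set_option maxHeartbeats 1000000
set_option maxSynthPendingDepth 3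

open Filter Topology

variable {E E' : Type*} [NormedAddCommGroup E] [NormedSpace ℝ E]
  [NormedAddCommGroup E'] [NormedSpace ℝ E']

/-! For orthonormal `X`, `Y` tangent to `M`, the Gauss equation writes `K(X ∧ Y)` as the ambient
value `g(R(X, Y)Y, X)` plus `g(σ(X, X), σ(Y, Y)) - ‖σ(X, Y)‖²`. Summed over an orthonormal basis,
the ambient part is a trace read off from the space-form formula (`sum_ambientCurvature`); on the
plane `π`, orthogonal to the structure vectors, it is only `F₁ + 3 F₂ F²(π)`. The difference
supplies every term of the bound except the one in `‖H‖²`.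

What is left concerns the vectors `s i j = σ(e_i, e_j)`, for a basis with `e 0`, `e 1` spanning `π`.
Group the diagonal into the `n + 1` vectors `s 0 0 + s 1 1, s 2 2, …`, whose sum is `(n + 2) H`. By
`chen_identity` the defect of the inequality is half the sum of the squared deviations of these
vectors from their mean, plus squared norms of the off-diagonal `s i j` other than `s 0 1`. Being a
sum of squares it is nonnegative, and it vanishes exactly when the `n + 1` vectors coincide and
those off-diagonal entries are zero (`IsChenIdeal`).

The argument is vector-valued and needs no normal frame; a frame enters only to express the equality
case by matrices. If its first vector is parallel to `s 0 0 + s 1 1`, the common diagonal value `c`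
is zero in all other normal directions.

Curvature and second fundamental form are defined by chart formulas, so the Gauss equation is proved
from these: `IsIsometryAt.gauss` differentiates `g'(∇'_b Dh w, Dh z) = g(∇_b w, z)` along `a` and
antisymmetrises in `a`, `b`. -/

theorem two_le_infty : minSmoothness ℝ 2 ≤ ∞ := by
  rw [minSmoothness_of_isRCLikeNormedField]
  exact WithTop.coe_le_coe.2 (le_top (a := (2 : ℕ∞)))

theorem fderiv_clm_apply_apply {F F' K : Type*} [NormedAddCommGroup F] [NormedSpace ℝ F]
    [NormedAddCommGroup F'] [NormedSpace ℝ F'] [NormedAddCommGroup K] [NormedSpace ℝ K]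
    {A : E → F →L[ℝ] F' →L[ℝ] K} {a : E → F} {b : E → F'} {y : E}
    (hA : DifferentiableAt ℝ A y) (ha : DifferentiableAt ℝ a y) (hb : DifferentiableAt ℝ b y)
    (u : E) :
    fderiv ℝ (fun z ↦ A z (a z) (b z)) y u =
      fderiv ℝ A y u (a y) (b y) + A y (fderiv ℝ a y u) (b y) + A y (a y) (fderiv ℝ b y u) := by
  rw [((hA.hasFDerivAt.clm_apply ha.hasFDerivAt).clm_apply hb.hasFDerivAt).fderiv]
  simp
  abel

/-- `G` is, near `y`, a smooth field of symmetric bilinear forms, nondegenerate at `y`. -/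
structure IsMetricAt (G : E → E →L[ℝ] E →L[ℝ] ℝ) (y : E) : Prop where
  contDiffAt : ContDiffAt ℝ ∞ G y
  symm : ∀ᶠ z in 𝓝 y, ∀ u v, G z u v = G z v u
  isInvertible : (G y).IsInvertible

/-! ### Levi-Civita properties of the Christoffel symbols. -/

namespace IsMetricAt

variable {G : E → E →L[ℝ] E →L[ℝ] ℝ} {y : E}

theorem differentiableAt (hG : IsMetricAt G y) : DifferentiableAt ℝ G y :=
  hG.contDiffAt.differentiableAt (by simp)

theorem apply_comm (hG : IsMetricAt G y) (u v : E) : G y u v = G y v u :=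
  hG.symm.self_of_nhds u v

theorem ext_left (hG : IsMetricAt G y) {u v : E} (h : ∀ w, G y u w = G y v w) : u = v :=
  hG.isInvertible.injective (ContinuousLinearMap.ext h)

theorem fderiv_apply (hG : IsMetricAt G y) (u v w : E) :
    fderiv ℝ (fun z ↦ G z v w) y u = fderiv ℝ G y u v w := by
  rw [fderiv_clm_apply_apply hG.differentiableAt (differentiableAt_const v)
    (differentiableAt_const w)]
  simp

theorem fderiv_comm (hG : IsMetricAt G y) (u v w : E) :
    fderiv ℝ G y u v w = fderiv ℝ G y u w v := by
  rw [← hG.fderiv_apply, ← hG.fderiv_apply]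
  congr 1
  exact EventuallyEq.fderiv_eq (hG.symm.mono fun z hz ↦ hz v w)

theorem apply_christoffel (hG : IsMetricAt G y) (u v w : E) :
    G y (christoffel G y u v) w = christoffelFirst G y u v w := by
  rw [christoffel_apply, hG.isInvertible.self_apply_inverse]

theorem christoffel_comm (hG : IsMetricAt G y) (u v : E) :
    christoffel G y u v = christoffel G y v u := by
  refine hG.ext_left fun w ↦ ?_
  rw [hG.apply_christoffel, hG.apply_christoffel, christoffelFirst_apply, christoffelFirst_apply,
    hG.fderiv_comm w u v]
  ring

/-- Metric compatibility: in the sum of the two Koszul expressions the derivatives along `v` and `w`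
cancel. -/
theorem fderiv_eq (hG : IsMetricAt G y) (u v w : E) :
    fderiv ℝ G y u v w =
      G y (christoffel G y u v) w + G y v (christoffel G y u w) := by
  rw [hG.apply_comm v, hG.apply_christoffel, hG.apply_christoffel, christoffelFirst_apply,
    christoffelFirst_apply, hG.fderiv_comm w u v, hG.fderiv_comm v u w, hG.fderiv_comm u v w]
  ring

theorem contDiffAt_christoffelFirst (hG : IsMetricAt G y) :
    ContDiffAt ℝ ∞ (christoffelFirst G) y := by
  have hD : ContDiffAt ℝ ∞ (fderiv ℝ G) y := hG.contDiffAt.fderiv_right (by simp)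
  have hflip : ContDiffAt ℝ ∞ (fun z ↦ (fderiv ℝ G z).flip) y :=
    (ContinuousLinearMap.flipₗᵢ ℝ E E (E →L[ℝ] ℝ)).contDiff.contDiffAt.comp y hD
  exact ((hD.add hflip).sub (contDiffAt_const.clm_comp hflip)).const_smul _

theorem contDiffAt_christoffel [CompleteSpace E] (hG : IsMetricAt G y) :
    ContDiffAt ℝ ∞ (christoffel G) y := by
  have hinv : ContDiffAt ℝ ∞ (fun z ↦ (G z).inverse) y :=
    hG.isInvertible.contDiffAt_map_inverse.comp y hG.contDiffAt
  have hcomp : ContDiffAt ℝ ∞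
      (fun z ↦ ContinuousLinearMap.compL ℝ E (E →L[ℝ] ℝ) E (G z).inverse) y :=
    (ContinuousLinearMap.compL ℝ E (E →L[ℝ] ℝ) E).contDiff.contDiffAt.comp y hinv
  exact hcomp.clm_comp (f := christoffelFirst G) hG.contDiffAt_christoffelFirst

theorem differentiableAt_christoffel [CompleteSpace E] (hG : IsMetricAt G y) :
    DifferentiableAt ℝ (christoffel G) y :=
  hG.contDiffAt_christoffel.differentiableAt (by simp)

end IsMetricAt

/-- Near `y`, the map `h` is smooth and pulls the metric `G'` back to the metric `G`. -/
structure IsIsometryAt (G : E → E →L[ℝ] E →L[ℝ] ℝ) (G' : E' → E' →L[ℝ] E' →L[ℝ] ℝ) (h : E → E')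
    (y : E) : Prop where
  source : IsMetricAt G y
  target : IsMetricAt G' (h y)
  contDiffAt : ContDiffAt ℝ ∞ h y
  pullback : ∀ᶠ z in 𝓝 y, ∀ u v, G z u v = G' (h z) (fderiv ℝ h z u) (fderiv ℝ h z v)

/-- The covariant derivative `∇'_u (Dh v)` along `h` of the image of a constant field. -/
def alongDeriv (G' : E' → E' →L[ℝ] E' →L[ℝ] ℝ) (h : E → E') (y : E) : E →L[ℝ] E →L[ℝ] E' :=
  fderiv ℝ (fderiv ℝ h) y + (christoffel G' (h y)).bilinearComp (fderiv ℝ h y) (fderiv ℝ h y)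

theorem alongDeriv_apply (G' : E' → E' →L[ℝ] E' →L[ℝ] ℝ) (h : E → E') (y u v : E) :
    alongDeriv G' h y u v = fderiv ℝ (fderiv ℝ h) y u v +
      christoffel G' (h y) (fderiv ℝ h y u) (fderiv ℝ h y v) := rfl

theorem coordSecondFundamentalForm_eq (G : E → E →L[ℝ] E →L[ℝ] ℝ)
    (G' : E' → E' →L[ℝ] E' →L[ℝ] ℝ) (h : E → E') (y u v : E) :
    coordSecondFundamentalForm G G' h y u v =
      alongDeriv G' h y u v - fderiv ℝ h y (christoffel G y u v) := rfl

/-! ### Covariant derivatives along an isometric map. -/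

namespace IsIsometryAt

variable {G : E → E →L[ℝ] E →L[ℝ] ℝ} {G' : E' → E' →L[ℝ] E' →L[ℝ] ℝ} {h : E → E'} {y : E}

theorem apply_eq (H : IsIsometryAt G G' h y) (u v : E) :
    G y u v = G' (h y) (fderiv ℝ h y u) (fderiv ℝ h y v) :=
  H.pullback.self_of_nhds u v

theorem contDiffAt_fderiv (H : IsIsometryAt G G' h y) : ContDiffAt ℝ ∞ (fderiv ℝ h) y :=
  H.contDiffAt.fderiv_right (by simp)

theorem differentiableAt_fderiv (H : IsIsometryAt G G' h y) :
    DifferentiableAt ℝ (fderiv ℝ h) y :=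
  H.contDiffAt_fderiv.differentiableAt (by simp)

theorem differentiableAt_fderiv_apply (H : IsIsometryAt G G' h y) (v : E) :
    DifferentiableAt ℝ (fun z ↦ fderiv ℝ h z v) y :=
  H.differentiableAt_fderiv.clm_apply (differentiableAt_const v)

theorem fderiv_fderiv_apply (H : IsIsometryAt G G' h y) (u v : E) :
    fderiv ℝ (fun z ↦ fderiv ℝ h z v) y u = fderiv ℝ (fderiv ℝ h) y u v := by
  rw [fderiv_clm_apply H.differentiableAt_fderiv (differentiableAt_const v)]
  simp

theorem differentiableAt (H : IsIsometryAt G G' h y) : DifferentiableAt ℝ h y :=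
  H.contDiffAt.differentiableAt (by simp)

theorem fderiv_comp {F : Type*} [NormedAddCommGroup F] [NormedSpace ℝ F] {g : E' → F}
    (H : IsIsometryAt G G' h y) (hg : DifferentiableAt ℝ g (h y)) (u : E) :
    fderiv ℝ (fun z ↦ g (h z)) y u = fderiv ℝ g (h y) (fderiv ℝ h y u) := by
  have := _root_.fderiv_comp y hg H.differentiableAt
  exact congrArg (fun A : E →L[ℝ] F ↦ A u) this

theorem fderiv_fderiv_comm (H : IsIsometryAt G G' h y) (u v : E) :
    fderiv ℝ (fderiv ℝ h) y u v = fderiv ℝ (fderiv ℝ h) y v u :=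
  H.contDiffAt.isSymmSndFDerivAt two_le_infty u v

theorem fderiv_fderiv_fderiv_comm (H : IsIsometryAt G G' h y) (u v : E) :
    fderiv ℝ (fderiv ℝ (fderiv ℝ h)) y u v = fderiv ℝ (fderiv ℝ (fderiv ℝ h)) y v u :=
  H.contDiffAt_fderiv.isSymmSndFDerivAt two_le_infty u v

theorem alongDeriv_comm (H : IsIsometryAt G G' h y) (u v : E) :
    alongDeriv G' h y u v = alongDeriv G' h y v u := by
  rw [alongDeriv_apply, alongDeriv_apply, H.fderiv_fderiv_comm, H.target.christoffel_comm]

theorem coordSecondFundamentalForm_comm (H : IsIsometryAt G G' h y) (u v : E) :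
    coordSecondFundamentalForm G G' h y u v = coordSecondFundamentalForm G G' h y v u := by
  rw [coordSecondFundamentalForm_eq, coordSecondFundamentalForm_eq, H.alongDeriv_comm,
    H.source.christoffel_comm]

/-- Compatibility of the derivative along `h` with the metric. -/
theorem fderiv_target (H : IsIsometryAt G G' h y) {a b : E → E'} (ha : DifferentiableAt ℝ a y)
    (hb : DifferentiableAt ℝ b y) (u : E) :
    fderiv ℝ (fun z ↦ G' (h z) (a z) (b z)) y u =
      G' (h y) (fderiv ℝ a y u + christoffel G' (h y) (fderiv ℝ h y u) (a y)) (b y) +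
      G' (h y) (a y) (fderiv ℝ b y u + christoffel G' (h y) (fderiv ℝ h y u) (b y)) := by
  have hG' := H.target.differentiableAt
  rw [fderiv_clm_apply_apply (A := fun z ↦ G' (h z)) (hG'.comp y H.differentiableAt) ha hb,
    H.fderiv_comp (F := E' →L[ℝ] E' →L[ℝ] ℝ) hG', H.target.fderiv_eq]
  simp only [map_add, add_apply]
  ring

theorem fderiv_source_eq (H : IsIsometryAt G G' h y) (u v w : E) :
    fderiv ℝ G y u v w = G' (h y) (alongDeriv G' h y u v) (fderiv ℝ h y w) +
      G' (h y) (fderiv ℝ h y v) (alongDeriv G' h y u w) := by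
  rw [← H.source.fderiv_apply, EventuallyEq.fderiv_eq (H.pullback.mono fun z hz ↦ hz v w),
    H.fderiv_target (H.differentiableAt_fderiv_apply v) (H.differentiableAt_fderiv_apply w),
    H.fderiv_fderiv_apply, H.fderiv_fderiv_apply, alongDeriv_apply, alongDeriv_apply]

/-- Koszul's argument along `h`: the derivative is symmetric and compatible with `G'`, so three
permuted derivatives of the pulled-back metric determine its tangential part. -/
theorem target_alongDeriv (H : IsIsometryAt G G' h y) (u v w : E) :
    G' (h y) (alongDeriv G' h y u v) (fderiv ℝ h y w) = G y (christoffel G y u v) w := by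
  rw [H.source.apply_christoffel, christoffelFirst_apply, H.fderiv_source_eq, H.fderiv_source_eq,
    H.fderiv_source_eq, H.alongDeriv_comm v u, H.alongDeriv_comm w u, H.alongDeriv_comm w v,
    H.target.apply_comm (fderiv ℝ h y v), H.target.apply_comm (fderiv ℝ h y u)]
  ring

theorem target_coordSecondFundamentalForm (H : IsIsometryAt G G' h y) (u v w : E) :
    G' (h y) (coordSecondFundamentalForm G G' h y u v) (fderiv ℝ h y w) = 0 := by
  rw [coordSecondFundamentalForm_eq, map_sub, sub_apply, H.target_alongDeriv,
    ← H.apply_eq, sub_self]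

/-- Tangential and normal parts are orthogonal, so the cross terms vanish. -/
theorem target_alongDeriv_alongDeriv (H : IsIsometryAt G G' h y) (u v w z : E) :
    G' (h y) (alongDeriv G' h y u v) (alongDeriv G' h y w z) =
      G' (h y) (coordSecondFundamentalForm G G' h y u v) (coordSecondFundamentalForm G G' h y w z)
        + G y (christoffel G y u v) (christoffel G y w z) := by
  have h1 : ∀ a b, alongDeriv G' h y a b =
      coordSecondFundamentalForm G G' h y a b + fderiv ℝ h y (christoffel G y a b) := fun a b ↦ by
    rw [coordSecondFundamentalForm_eq, sub_add_cancel]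
  rw [h1, h1]
  simp only [map_add, add_apply, H.target_coordSecondFundamentalForm]
  rw [H.target.apply_comm (fderiv ℝ h y (christoffel G y u v)),
    H.target_coordSecondFundamentalForm, H.apply_eq]
  ring

variable [CompleteSpace E']

theorem differentiableAt_christoffel_comp (H : IsIsometryAt G G' h y) :
    DifferentiableAt ℝ (fun z ↦ christoffel G' (h z)) y :=
  H.target.differentiableAt_christoffel.comp y H.differentiableAt

theorem differentiableAt_alongDeriv_apply (H : IsIsometryAt G G' h y) (v w : E) :
    DifferentiableAt ℝ (fun z ↦ alongDeriv G' h z v w) y := by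
  simp only [alongDeriv_apply]
  have h2 : DifferentiableAt ℝ (fderiv ℝ (fderiv ℝ h)) y :=
    (H.contDiffAt_fderiv.fderiv_right (m := ∞) (by simp)).differentiableAt (by simp)
  exact ((h2.clm_apply (differentiableAt_const v)).clm_apply (differentiableAt_const w)).add
    (((H.differentiableAt_christoffel_comp).clm_apply
      (H.differentiableAt_fderiv_apply v)).clm_apply (H.differentiableAt_fderiv_apply w))

theorem fderiv_alongDeriv_apply (H : IsIsometryAt G G' h y) (u v w : E) :
    fderiv ℝ (fun z ↦ alongDeriv G' h z v w) y u =
      fderiv ℝ (fderiv ℝ (fderiv ℝ h)) y u v w +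
      (fderiv ℝ (christoffel G') (h y) (fderiv ℝ h y u) (fderiv ℝ h y v) (fderiv ℝ h y w) +
        christoffel G' (h y) (fderiv ℝ (fderiv ℝ h) y u v) (fderiv ℝ h y w) +
        christoffel G' (h y) (fderiv ℝ h y v) (fderiv ℝ (fderiv ℝ h) y u w)) := by
  simp only [alongDeriv_apply]
  have h2 : DifferentiableAt ℝ (fderiv ℝ (fderiv ℝ h)) y :=
    (H.contDiffAt_fderiv.fderiv_right (m := ∞) (by simp)).differentiableAt (by simp)
  have hΓ := H.differentiableAt_christoffel_comp
  have hv := H.differentiableAt_fderiv_apply v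
  have hw := H.differentiableAt_fderiv_apply w
  rw [fderiv_fun_add ((h2.clm_apply (differentiableAt_const v)).clm_apply
      (differentiableAt_const w)) ((hΓ.clm_apply hv).clm_apply hw),
    add_apply,
    fderiv_clm_apply_apply h2 (differentiableAt_const v) (differentiableAt_const w),
    fderiv_clm_apply_apply hΓ hv hw, H.fderiv_comp (F := E' →L[ℝ] E' →L[ℝ] E') H.target.differentiableAt_christoffel,
    H.fderiv_fderiv_apply, H.fderiv_fderiv_apply]
  simp

/-- The antisymmetrised second derivative along `h` is the curvature of the target. -/
theorem alongDeriv_antisymm (H : IsIsometryAt G G' h y) (u v w : E) :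
    (fderiv ℝ (fun z ↦ alongDeriv G' h z v w) y u +
        christoffel G' (h y) (fderiv ℝ h y u) (alongDeriv G' h y v w)) -
      (fderiv ℝ (fun z ↦ alongDeriv G' h z u w) y v +
        christoffel G' (h y) (fderiv ℝ h y v) (alongDeriv G' h y u w)) =
      coordCurvature G' (h y) (fderiv ℝ h y u) (fderiv ℝ h y v) (fderiv ℝ h y w) := by
  -- By symmetry, the third derivatives of `h`, and the Christoffel terms in its second derivatives,
  -- cancel.
  rw [H.fderiv_alongDeriv_apply, H.fderiv_alongDeriv_apply, H.fderiv_fderiv_fderiv_comm u v,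
    H.fderiv_fderiv_comm u v, coordCurvature, alongDeriv_apply, alongDeriv_apply]
  simp only [map_add]
  abel

/-- The Gauss equation. -/
theorem gauss [CompleteSpace E] (H : ∀ᶠ z in 𝓝 y, IsIsometryAt G G' h z) (u v w z : E) :
    G y (coordCurvature G y u v w) z =
      G' (h y) (coordCurvature G' (h y) (fderiv ℝ h y u) (fderiv ℝ h y v) (fderiv ℝ h y w))
          (fderiv ℝ h y z)
        + G' (h y) (coordSecondFundamentalForm G G' h y v w)
            (coordSecondFundamentalForm G G' h y u z)
        - G' (h y) (coordSecondFundamentalForm G G' h y u w)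
            (coordSecondFundamentalForm G G' h y v z) := by
  have H₀ := H.self_of_nhds
  -- The derivative along `a` of `target_alongDeriv`, which holds near `y`, expanded by metric
  -- compatibility on both sides. No derivative of the second fundamental form occurs.
  have key (a b : E) :
      G' (h y) (fderiv ℝ (fun z ↦ alongDeriv G' h z b w) y a +
          christoffel G' (h y) (fderiv ℝ h y a) (alongDeriv G' h y b w)) (fderiv ℝ h y z)
        + G' (h y) (alongDeriv G' h y b w) (alongDeriv G' h y a z) =
      G y (fderiv ℝ (christoffel G) y a b w + christoffel G y a (christoffel G y b w)) z
        + G y (christoffel G y b w) (christoffel G y a z) := by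
    have e := EventuallyEq.fderiv_eq (𝕜 := ℝ) (H.mono fun q hq ↦ hq.target_alongDeriv b w z)
    have e := congrArg (fun A : E →L[ℝ] ℝ ↦ A a) e
    have hΓ := H₀.source.differentiableAt_christoffel
    rw [H₀.fderiv_target (H₀.differentiableAt_alongDeriv_apply b w)
        (H₀.differentiableAt_fderiv_apply z), H₀.fderiv_fderiv_apply, ← alongDeriv_apply,
      fderiv_clm_apply_apply H₀.source.differentiableAt
        ((hΓ.clm_apply (differentiableAt_const b)).clm_apply (differentiableAt_const w))
        (differentiableAt_const z),
      fderiv_clm_apply_apply hΓ (differentiableAt_const b) (differentiableAt_const w),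
      H₀.source.fderiv_eq] at e
    rw [e]
    simp
    ring
  have k1 := key u v
  have k2 := key v u
  rw [← H₀.alongDeriv_antisymm, coordCurvature]
  rw [H₀.target_alongDeriv_alongDeriv] at k1 k2
  simp only [map_add, map_sub, add_apply, sub_apply]
    at k1 k2 ⊢
  linarith

end IsIsometryAt

theorem IsMetricAt.comp_equiv {G : E → E →L[ℝ] E →L[ℝ] ℝ} {G' : E' → E' →L[ℝ] E' →L[ℝ] ℝ}
    {y : E} (e : E ≃L[ℝ] E') (h : ∀ z u v, G z u v = G' (e z) (e u) (e v))
    (hG' : IsMetricAt G' (e y)) : IsMetricAt G y where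
  contDiffAt := by
    have h1 : ContDiffAt ℝ ∞ (fun z ↦ G' (e z)) y := hG'.contDiffAt.comp y e.contDiff.contDiffAt
    have h2 : ContDiffAt ℝ ∞ (fun z ↦ (G' (e z)).comp (e : E →L[ℝ] E')) y :=
      h1.clm_comp contDiffAt_const
    have h3 : ContDiffAt ℝ ∞ (fun z ↦ ((G' (e z)).comp (e : E →L[ℝ] E')).flip) y :=
      (ContinuousLinearMap.flipₗᵢ ℝ E E' ℝ).contDiff.contDiffAt.comp y h2
    have h4 : ContDiffAt ℝ ∞
        (fun z ↦ ((G' (e z)).comp (e : E →L[ℝ] E')).flip.comp (e : E →L[ℝ] E')) y :=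
      h3.clm_comp contDiffAt_const
    have h5 : ContDiffAt ℝ ∞
        (fun z ↦ (((G' (e z)).comp (e : E →L[ℝ] E')).flip.comp (e : E →L[ℝ] E')).flip) y :=
      (ContinuousLinearMap.flipₗᵢ ℝ E E ℝ).contDiff.contDiffAt.comp y h4
    refine h5.congr_of_eventuallyEq (Eventually.of_forall fun z ↦ ?_)
    ext u v
    exact h z u v
  symm := by
    filter_upwards [e.continuous.continuousAt.eventually hG'.symm] with z hz u v
    rw [h, h, hz]
  isInvertible := by
    obtain ⟨B, hB⟩ := hG'.isInvertible
    refine ⟨(e.trans B).trans (e.symm.arrowCongr (ContinuousLinearEquiv.refl ℝ ℝ)), ?_⟩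
    ext u v
    rw [h, ← hB]
    rfl

/-- Invariance of the curvature under linear changes of coordinates. -/
theorem coordCurvature_comp_equiv [CompleteSpace E] [CompleteSpace E']
    {G : E → E →L[ℝ] E →L[ℝ] ℝ} {G' : E' → E' →L[ℝ] E' →L[ℝ] ℝ}
    {y : E} (e : E ≃L[ℝ] E') (h : ∀ z u v, G z u v = G' (e z) (e u) (e v))
    (hG' : ∀ᶠ z in 𝓝 (e y), IsMetricAt G' z) (u v w : E) :
    e (coordCurvature G y u v w) = coordCurvature G' (e y) (e u) (e v) (e w) := by
  have H : ∀ᶠ z in 𝓝 y, IsIsometryAt G G' e z := by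
    filter_upwards [e.continuous.continuousAt.eventually hG'] with z hz
    exact ⟨hz.comp_equiv e h, hz, e.contDiff.contDiffAt,
      Eventually.of_forall fun q a b ↦ by rw [e.fderiv]; exact h q a b⟩
  have H₀ := H.self_of_nhds
  -- A linear isomorphism is onto, so a vector normal to its image is zero; the Gauss equation then
  -- has no correction terms.
  have hσ (a b : E) : coordSecondFundamentalForm G G' e y a b = 0 := by
    refine H₀.target.ext_left fun c ↦ ?_
    have := H₀.target_coordSecondFundamentalForm a b (e.symm c)
    rw [e.fderiv] at this
    simpa using this
  refine H₀.target.ext_left fun c ↦ ?_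
  have g := IsIsometryAt.gauss H u v w (e.symm c)
  rw [hσ v w, hσ u w, h, e.fderiv] at g
  simpa using g

end CoordinateGauss

/-! ## From manifolds to charts -/

section Charts

set_option linter.unusedSectionVars false

open Filter Topology

theorem isInvertible_of_forall_eq_zero {E : Type*} [NormedAddCommGroup E] [NormedSpace ℝ E]
    [FiniteDimensional ℝ E] {B : E →L[ℝ] E →L[ℝ] ℝ} (hB : ∀ u, B u u = 0 → u = 0) :
    B.IsInvertible := by
  have hinj : Function.Injective (B : E →ₗ[ℝ] E →L[ℝ] ℝ) := by
    refine (injective_iff_map_eq_zero _).2 fun u hu ↦ hB u ?_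
    have hu : B u = 0 := hu
    rw [hu]; rfl
  have hdim : Module.finrank ℝ E = Module.finrank ℝ (E →L[ℝ] ℝ) := by
    rw [← Subspace.dual_finrank_eq, ← LinearMap.toContinuousLinearMap.finrank_eq]
  exact ⟨(LinearMap.linearEquivOfInjective _ hinj hdim).toContinuousLinearEquiv,
    ContinuousLinearMap.ext fun u ↦ rfl⟩

theorem contDiffAt_clm_apply {E F D : Type*} [NormedAddCommGroup E] [NormedSpace ℝ E]
    [NormedAddCommGroup F] [NormedSpace ℝ F] [NormedAddCommGroup D] [NormedSpace ℝ D]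
    [FiniteDimensional ℝ E] {f : D → E →L[ℝ] F} {s : Set D} (hs : IsOpen s)
    (h : ∀ v, ContDiffOn ℝ ∞ (fun x ↦ f x v) s) {x : D} (hx : x ∈ s) : ContDiffAt ℝ ∞ f x :=
  (contDiffOn_clm_apply.2 h).contDiffAt (hs.mem_nhds hx)

variable {d k : ℕ}
  {M : Type*} [TopologicalSpace M] [ChartedSpace (EuclideanSpace ℝ (Fin d)) M]
  {N : Type*} [TopologicalSpace N] [ChartedSpace (EuclideanSpace ℝ (Fin k)) N]
  {ι : M → N}

theorem mfderiv_eq_fderiv_writtenInExtChartAt (hι : ContMDiff (𝓡 d) (𝓡 k) ∞ ι) (p : M)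
    (X : TangentSpace (𝓡 d) p) :
    mfderiv (𝓡 d) (𝓡 k) ι p X =
      fderiv ℝ (writtenInExtChartAt (𝓡 d) (𝓡 k) p ι) (extChartAt (𝓡 d) p p) X := by
  have h1 : fderivWithin ℝ (writtenInExtChartAt (𝓡 d) (𝓡 k) p ι) (Set.range (𝓡 d))
      (extChartAt (𝓡 d) p p) = fderiv ℝ (writtenInExtChartAt (𝓡 d) (𝓡 k) p ι)
      (extChartAt (𝓡 d) p p) := by
    rw [ModelWithCorners.range_eq_univ, fderivWithin_univ]
  have h2 : MDifferentiableAt (𝓡 d) (𝓡 k) ι p := hι.mdifferentiableAt (by simp)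
  exact (DFunLike.congr_fun h2.mfderiv X).trans (DFunLike.congr_fun h1 X)

theorem writtenInExtChartAt_self (ι : M → N) (p : M) :
    writtenInExtChartAt (𝓡 d) (𝓡 k) p ι (extChartAt (𝓡 d) p p) = extChartAt (𝓡 k) (ι p) (ι p) :=
  congrArg (fun q ↦ extChartAt (𝓡 k) (ι p) (ι q)) (extChartAt_to_inv p)

variable [IsManifold (𝓡 d) ∞ M]

/-- At its centre, the preferred chart induces the identity on the tangent space; this matches the
chart metric there with the inner product. -/
theorem symmL_trivializationAt_self (x : M) (u : TangentSpace (𝓡 d) x) :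
    (trivializationAt (EuclideanSpace ℝ (Fin d)) (TangentSpace (𝓡 d) (M := M)) x).symmL ℝ x u
      = u := by
  have := IsManifold.of_le (I := 𝓡 d) (M := M) (m := 1) (n := ∞) (by simp)
  rw [TangentBundle.symmL_trivializationAt (mem_chart_source _ x),
    mfderivWithin_range_extChartAt_symm]
  rfl

theorem mfderiv_extChartAt_symm_apply (x : M) {z : EuclideanSpace ℝ (Fin d)}
    (hz : z ∈ (extChartAt (𝓡 d) x).target) (u : EuclideanSpace ℝ (Fin d)) :
    mfderiv 𝓘(ℝ, EuclideanSpace ℝ (Fin d)) (𝓡 d) (extChartAt (𝓡 d) x).symm z u =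
      (trivializationAt (EuclideanSpace ℝ (Fin d)) (TangentSpace (𝓡 d) (M := M)) x).symmL ℝ
        ((extChartAt (𝓡 d) x).symm z) u := by
  have := IsManifold.of_le (I := 𝓡 d) (M := M) (m := 1) (n := ∞) (by simp)
  have hq : (extChartAt (𝓡 d) x).symm z ∈ (chartAt (EuclideanSpace ℝ (Fin d)) x).source := by
    rw [← extChartAt_source (𝓡 d)]
    exact (extChartAt (𝓡 d) x).map_target hz
  -- The codomain of `D` is fixed, so its argument can be rewritten although the tangent spaces
  -- depend on the point.
  let D : EuclideanSpace ℝ (Fin d) → EuclideanSpace ℝ (Fin d) →L[ℝ] EuclideanSpace ℝ (Fin d) :=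
    fun z ↦ mfderivWithin 𝓘(ℝ, EuclideanSpace ℝ (Fin d)) (𝓡 d) (extChartAt (𝓡 d) x).symm
      (Set.range (𝓡 d)) z
  have h1 : D z u = D (extChartAt (𝓡 d) x ((extChartAt (𝓡 d) x).symm z)) u := by
    rw [(extChartAt (𝓡 d) x).right_inv hz]
  have h2 := TangentBundle.symmL_trivializationAt (I := 𝓡 d) hq
  have h3 : D z = mfderiv 𝓘(ℝ, EuclideanSpace ℝ (Fin d)) (𝓡 d) (extChartAt (𝓡 d) x).symm z := by
    simp only [D, ModelWithCorners.range_eq_univ, mfderivWithin_univ]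
    rfl
  exact (DFunLike.congr_fun h3 u).symm.trans (h1.trans (DFunLike.congr_fun h2 u).symm)

variable [IsManifold (𝓡 k) ∞ N]

theorem fderiv_writtenInExtChartAt (hι : ContMDiff (𝓡 d) (𝓡 k) ∞ ι) (p : M)
    {z : EuclideanSpace ℝ (Fin d)} (hz : z ∈ (extChartAt (𝓡 d) p).target)
    (hz' : ι ((extChartAt (𝓡 d) p).symm z) ∈ (chartAt (EuclideanSpace ℝ (Fin k)) (ι p)).source)
    (u : EuclideanSpace ℝ (Fin d)) :
    fderiv ℝ (writtenInExtChartAt (𝓡 d) (𝓡 k) p ι) z u =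
      (trivializationAt (EuclideanSpace ℝ (Fin k)) (TangentSpace (𝓡 k) (M := N))
        (ι p)).continuousLinearMapAt ℝ (ι ((extChartAt (𝓡 d) p).symm z))
          (mfderiv (𝓡 d) (𝓡 k) ι ((extChartAt (𝓡 d) p).symm z)
          ((trivializationAt (EuclideanSpace ℝ (Fin d)) (TangentSpace (𝓡 d) (M := M)) p).symmL ℝ
            ((extChartAt (𝓡 d) p).symm z) u)) := by
  have := IsManifold.of_le (I := 𝓡 d) (M := M) (m := 1) (n := ∞) (by simp)
  have := IsManifold.of_le (I := 𝓡 k) (M := N) (m := 1) (n := ∞) (by simp)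
  have hd1 : MDifferentiableAt 𝓘(ℝ, EuclideanSpace ℝ (Fin d)) (𝓡 d) (extChartAt (𝓡 d) p).symm z :=
    ((contMDiffOn_extChartAt_symm (n := 1) p).contMDiffAt
      ((isOpen_extChartAt_target p).mem_nhds hz)).mdifferentiableAt (by simp)
  have hd2 : MDifferentiableAt (𝓡 d) (𝓡 k) ι ((extChartAt (𝓡 d) p).symm z) :=
    hι.mdifferentiableAt (by simp)
  have hd3 := mdifferentiableAt_extChartAt (I := 𝓡 k) hz'
  have h1 := TangentBundle.continuousLinearMapAt_trivializationAt (I := 𝓡 k) hz'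
  rw [← mfderiv_extChartAt_symm_apply p hz, h1, ← mfderiv_eq_fderiv]
  exact (mfderiv_comp_apply z hd3 (hd2.comp z hd1) u).trans
    (congrArg _ (mfderiv_comp_apply z hd2 hd1 u))

variable [RiemannianBundle (fun x : N ↦ TangentSpace (𝓡 k) x)]
  [RiemannianBundle (fun x : M ↦ TangentSpace (𝓡 d) x)]

theorem metricInChart_extChartAt (x : M) {q : M} (hq : q ∈ (extChartAt (𝓡 d) x).source)
    (u v : EuclideanSpace ℝ (Fin d)) :
    metricInChart x (extChartAt (𝓡 d) x q) u v = inner ℝ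
      ((trivializationAt (EuclideanSpace ℝ (Fin d)) (TangentSpace (𝓡 d) (M := M)) x).symmL ℝ q u)
      ((trivializationAt (EuclideanSpace ℝ (Fin d)) (TangentSpace (𝓡 d) (M := M)) x).symmL ℝ q v)
      := by
  rw [metricInChart_apply]
  -- The vectors lie in tangent spaces depending on the point, so the point is generalised before
  -- substituting.
  have key : ∀ q' : M, q' = q → inner ℝ
      ((trivializationAt (EuclideanSpace ℝ (Fin d)) (TangentSpace (𝓡 d) (M := M)) x).symmL ℝ q' u)
      ((trivializationAt (EuclideanSpace ℝ (Fin d)) (TangentSpace (𝓡 d) (M := M)) x).symmL ℝ q' v)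
      = inner ℝ
      ((trivializationAt (EuclideanSpace ℝ (Fin d)) (TangentSpace (𝓡 d) (M := M)) x).symmL ℝ q u)
      ((trivializationAt (EuclideanSpace ℝ (Fin d)) (TangentSpace (𝓡 d) (M := M)) x).symmL ℝ q v)
      := by
    rintro _ rfl
    rfl
  exact key _ ((extChartAt (𝓡 d) x).left_inv hq)

theorem metricInChart_self (x : M) (u v : TangentSpace (𝓡 d) x) :
    metricInChart x (extChartAt (𝓡 d) x x) u v = inner ℝ u v := by
  exact (metricInChart_extChartAt x (mem_extChartAt_source x) u v).trans
    (congrArg₂ (fun a b : TangentSpace (𝓡 d) x ↦ inner ℝ a b) (symmL_trivializationAt_self x u)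
      (symmL_trivializationAt_self x v))

theorem isMetricAt_metricInChart
    [IsContMDiffRiemannianBundle (𝓡 d) ∞ (EuclideanSpace ℝ (Fin d))
      (fun x : M ↦ TangentSpace (𝓡 d) x)] (x : M) {y : EuclideanSpace ℝ (Fin d)}
    (hy : y ∈ (extChartAt (𝓡 d) x).target) : IsMetricAt (metricInChart x) y where
  contDiffAt := by
    refine contDiffAt_clm_apply (isOpen_extChartAt_target x) (fun u ↦ ?_) hy
    refine contDiffOn_clm_apply.2 fun v ↦ ?_
    -- The coordinate field with constant components `w` is a smooth section, as the inverse
    -- trivialization is smooth.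
    have hsec (w : EuclideanSpace ℝ (Fin d)) : ContMDiffOn (𝓡 d) (𝓡 d).tangent ∞ (fun z ↦
        (⟨(extChartAt (𝓡 d) x).symm z, (trivializationAt (EuclideanSpace ℝ (Fin d))
          (TangentSpace (𝓡 d) (M := M)) x).symmL ℝ ((extChartAt (𝓡 d) x).symm z) w⟩ :
          TangentBundle (𝓡 d) M)) (extChartAt (𝓡 d) x).target := by
      have h1 := (trivializationAt (EuclideanSpace ℝ (Fin d))
        (TangentSpace (𝓡 d) (M := M)) x).contMDiffOn_symm (IB := 𝓡 d) (n := ∞)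
      have h2 : ContMDiffOn (𝓡 d) ((𝓡 d).prod 𝓘(ℝ, EuclideanSpace ℝ (Fin d))) ∞
          (fun z ↦ ((extChartAt (𝓡 d) x).symm z, w)) (extChartAt (𝓡 d) x).target :=
        (contMDiffOn_extChartAt_symm x).prodMk contMDiffOn_const
      have hmem : ∀ z ∈ (extChartAt (𝓡 d) x).target, (extChartAt (𝓡 d) x).symm z ∈
          (trivializationAt (EuclideanSpace ℝ (Fin d))
            (TangentSpace (𝓡 d) (M := M)) x).baseSet := fun z hz ↦ by
        rw [TangentBundle.trivializationAt_baseSet, ← extChartAt_source (𝓡 d)]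
        exact (extChartAt (𝓡 d) x).map_target hz
      refine (h1.comp h2 fun z hz ↦ ?_).congr fun z hz ↦ ?_
      · rw [Set.mem_preimage, Trivialization.mem_target]
        exact hmem z hz
      · rw [Function.comp_apply, ← Trivialization.mk_symm _ (hmem z hz),
          Trivialization.symmL_apply _ (hmem z hz)]
    exact ((hsec u).inner_bundle (hsec v)).contDiffOn
  symm := Eventually.of_forall fun z u v ↦ by
    rw [metricInChart_apply, metricInChart_apply, real_inner_comm]
  isInvertible := by
    refine isInvertible_of_forall_eq_zero fun u hu ↦ ?_
    rw [metricInChart_apply, inner_self_eq_zero] at hu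
    have hmem : (extChartAt (𝓡 d) x).symm y ∈ (trivializationAt (EuclideanSpace ℝ (Fin d))
        (TangentSpace (𝓡 d) (M := M)) x).baseSet := by
      rw [TangentBundle.trivializationAt_baseSet, ← extChartAt_source (𝓡 d)]
      exact (extChartAt (𝓡 d) x).map_target hy
    rw [← Trivialization.continuousLinearMapAt_symmL _ (R := ℝ) hmem u, hu, map_zero]

theorem eventually_isIsometryAt
    [IsContMDiffRiemannianBundle (𝓡 d) ∞ (EuclideanSpace ℝ (Fin d))
      (fun x : M ↦ TangentSpace (𝓡 d) x)]
    [IsContMDiffRiemannianBundle (𝓡 k) ∞ (EuclideanSpace ℝ (Fin k))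
      (fun x : N ↦ TangentSpace (𝓡 k) x)]
    (hι : IsIsometricImmersion d k ι) (p : M) :
    ∀ᶠ y in 𝓝 (extChartAt (𝓡 d) p p), IsIsometryAt (metricInChart p) (metricInChart (ι p))
      (writtenInExtChartAt (𝓡 d) (𝓡 k) p ι) y := by
  -- The chart points whose image under `ι` stays in the chart at `ι p`. An open set is needed
  -- because the isometry relations get differentiated.
  let U : Set (EuclideanSpace ℝ (Fin d)) := (extChartAt (𝓡 d) p).target ∩
    (extChartAt (𝓡 d) p).symm ⁻¹' (ι ⁻¹' (chartAt (EuclideanSpace ℝ (Fin k)) (ι p)).source)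
  have hU : IsOpen U := (continuousOn_extChartAt_symm p).isOpen_inter_preimage
    (isOpen_extChartAt_target p)
    ((chartAt (EuclideanSpace ℝ (Fin k)) (ι p)).open_source.preimage hι.contMDiff.continuous)
  have hpU : extChartAt (𝓡 d) p p ∈ U := by
    refine ⟨mem_extChartAt_target p, ?_⟩
    rw [Set.mem_preimage, extChartAt_to_inv]
    exact mem_chart_source _ (ι p)
  have hval (z : EuclideanSpace ℝ (Fin d)) : writtenInExtChartAt (𝓡 d) (𝓡 k) p ι z =
      extChartAt (𝓡 k) (ι p) (ι ((extChartAt (𝓡 d) p).symm z)) := rfl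
  have hsrc (z : EuclideanSpace ℝ (Fin d)) (hz : z ∈ U) :
      ι ((extChartAt (𝓡 d) p).symm z) ∈ (extChartAt (𝓡 k) (ι p)).source := by
    rw [extChartAt_source]; exact hz.2
  filter_upwards [hU.mem_nhds hpU] with y hy
  refine ⟨isMetricAt_metricInChart p hy.1, isMetricAt_metricInChart (ι p) ?_, ?_, ?_⟩
  · rw [hval]
    exact (extChartAt (𝓡 k) (ι p)).map_source (hsrc y hy)
  · have h1 : ContMDiffAt (𝓡 d) (𝓡 d) ∞ (extChartAt (𝓡 d) p).symm y :=
      (contMDiffOn_extChartAt_symm p).contMDiffAt ((isOpen_extChartAt_target p).mem_nhds hy.1)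
    have h3 : ContMDiffAt (𝓡 k) (𝓡 k) ∞ (extChartAt (𝓡 k) (ι p))
        (ι ((extChartAt (𝓡 d) p).symm y)) := contMDiffAt_extChartAt' hy.2
    exact (h3.comp y (hι.contMDiff.contMDiffAt.comp y h1)).contDiffAt
  · filter_upwards [hU.mem_nhds hy] with z hz u v
    rw [hval, metricInChart_extChartAt (ι p) (hsrc z hz),
      fderiv_writtenInExtChartAt hι.contMDiff p hz.1 hz.2,
      fderiv_writtenInExtChartAt hι.contMDiff p hz.1 hz.2,
      Trivialization.symmL_continuousLinearMapAt _ (by exact hz.2),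
      Trivialization.symmL_continuousLinearMapAt _ (by exact hz.2), hι.inner_mfderiv,
      metricInChart_apply]

variable [IsContMDiffRiemannianBundle (𝓡 d) ∞ (EuclideanSpace ℝ (Fin d))
      (fun x : M ↦ TangentSpace (𝓡 d) x)]
    [IsContMDiffRiemannianBundle (𝓡 k) ∞ (EuclideanSpace ℝ (Fin k))
      (fun x : N ↦ TangentSpace (𝓡 k) x)]

variable (k) in
/-- The identification of a tangent space with the model space. -/
def tangentCoord (x : N) : TangentSpace (𝓡 k) x ≃L[ℝ] EuclideanSpace ℝ (Fin k) :=
  ContinuousLinearEquiv.refl ℝ (EuclideanSpace ℝ (Fin k))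

theorem metricInChart_tangentCoord (x : N) (u v : TangentSpace (𝓡 k) x) :
    metricInChart x (extChartAt (𝓡 k) x x) (tangentCoord k x u) (tangentCoord k x v) =
      inner ℝ u v :=
  metricInChart_self x u v

/-- The defining formula is elaborated on the tangent space with its Riemannian norm, while the
charts use the Euclidean norm. The identity `tangentCoord` is a linear homeomorphism between the
two, and `coordCurvature_comp_equiv` passes across it. -/
theorem curvature_eq_coordCurvature (x : N) (X Y Z : TangentSpace (𝓡 k) x) :
    curvature x X Y Z = coordCurvature (E := TangentSpace (𝓡 k) x) (metricInChart x)
      (extChartAt (𝓡 k) x x) X Y Z := rfl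

theorem metricInChart_apply_tangentCoord (x : N) (z u v : TangentSpace (𝓡 k) x) :
    (metricInChart x :
        TangentSpace (𝓡 k) x → TangentSpace (𝓡 k) x →L[ℝ] TangentSpace (𝓡 k) x →L[ℝ] ℝ) z u v =
      metricInChart x (tangentCoord k x z) (tangentCoord k x u) (tangentCoord k x v) := rfl

theorem tangentCoord_curvature (x : N) (X Y Z : TangentSpace (𝓡 k) x) :
    tangentCoord k x (curvature x X Y Z) =
      coordCurvature (metricInChart x) (extChartAt (𝓡 k) x x) (tangentCoord k x X)
        (tangentCoord k x Y) (tangentCoord k x Z) := by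
  have hG' : ∀ᶠ z in 𝓝 (extChartAt (𝓡 k) x x), IsMetricAt (metricInChart x) z := by
    filter_upwards [extChartAt_target_mem_nhds (I := 𝓡 k) x] with z hz
    exact isMetricAt_metricInChart x hz
  rw [curvature_eq_coordCurvature]
  exact coordCurvature_comp_equiv (tangentCoord k x) (metricInChart_apply_tangentCoord x) hG' X Y Z

theorem tangentCoord_mfderiv (hι : ContMDiff (𝓡 d) (𝓡 k) ∞ ι) (p : M)
    (X : TangentSpace (𝓡 d) p) :
    fderiv ℝ (writtenInExtChartAt (𝓡 d) (𝓡 k) p ι) (extChartAt (𝓡 d) p p) (tangentCoord d p X) =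
      tangentCoord k (ι p) (mfderiv (𝓡 d) (𝓡 k) ι p X) :=
  (mfderiv_eq_fderiv_writtenInExtChartAt hι p X).symm

theorem tangentCoord_secondFundamentalForm (p : M) (X Y : TangentSpace (𝓡 d) p) :
    coordSecondFundamentalForm (metricInChart p) (metricInChart (ι p))
      (writtenInExtChartAt (𝓡 d) (𝓡 k) p ι) (extChartAt (𝓡 d) p p)
      (tangentCoord d p X) (tangentCoord d p Y) =
    tangentCoord k (ι p) (secondFundamentalForm d k ι p X Y) := rfl

theorem secondFundamentalForm_comm (hι : IsIsometricImmersion d k ι) (p : M)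
    (X Y : TangentSpace (𝓡 d) p) :
    secondFundamentalForm d k ι p X Y = secondFundamentalForm d k ι p Y X :=
  (eventually_isIsometryAt hι p).self_of_nhds.coordSecondFundamentalForm_comm X Y

theorem inner_secondFundamentalForm_mfderiv (hι : IsIsometricImmersion d k ι) (p : M)
    (X Y Z : TangentSpace (𝓡 d) p) :
    inner ℝ (secondFundamentalForm d k ι p X Y) (mfderiv (𝓡 d) (𝓡 k) ι p Z) = 0 := by
  have h := (eventually_isIsometryAt hι p).self_of_nhds.target_coordSecondFundamentalForm
    (tangentCoord d p X) (tangentCoord d p Y) (tangentCoord d p Z)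
  rwa [tangentCoord_mfderiv hι.contMDiff, tangentCoord_secondFundamentalForm,
    writtenInExtChartAt_self, metricInChart_tangentCoord] at h

/-- The Gauss equation of an isometric immersion. -/
theorem gauss_equation (hι : IsIsometricImmersion d k ι) (p : M)
    (X Y Z W : TangentSpace (𝓡 d) p) :
    inner ℝ (curvature p X Y Z) W =
      inner ℝ (curvature (ι p) (mfderiv (𝓡 d) (𝓡 k) ι p X) (mfderiv (𝓡 d) (𝓡 k) ι p Y)
        (mfderiv (𝓡 d) (𝓡 k) ι p Z)) (mfderiv (𝓡 d) (𝓡 k) ι p W)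
      + inner ℝ (secondFundamentalForm d k ι p Y Z) (secondFundamentalForm d k ι p X W)
      - inner ℝ (secondFundamentalForm d k ι p X Z) (secondFundamentalForm d k ι p Y W) := by
  have h := IsIsometryAt.gauss (eventually_isIsometryAt hι p) (tangentCoord d p X)
    (tangentCoord d p Y) (tangentCoord d p Z) (tangentCoord d p W)
  simp only [tangentCoord_mfderiv hι.contMDiff, tangentCoord_secondFundamentalForm,
    writtenInExtChartAt_self] at h
  rwa [← tangentCoord_curvature, ← tangentCoord_curvature, metricInChart_tangentCoord,
    metricInChart_tangentCoord, metricInChart_tangentCoord, metricInChart_tangentCoord] at h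

end Charts

/-! ## Linear algebra -/

section LinearAlgebra

set_option linter.unusedSectionVars false

variable {V W : Type*} [NormedAddCommGroup V] [InnerProductSpace ℝ V]
  [NormedAddCommGroup W] [InnerProductSpace ℝ W]

/-- The metric trace of a bilinear map does not depend on the orthonormal basis. -/
theorem sum_bilin_orthonormalBasis {κ κ' F : Type*} [Fintype κ] [Fintype κ'] [AddCommGroup F]
    [Module ℝ F] (b : OrthonormalBasis κ ℝ V) (b' : OrthonormalBasis κ' ℝ V)
    (β : V →ₗ[ℝ] V →ₗ[ℝ] F) : ∑ i, β (b i) (b i) = ∑ j, β (b' j) (b' j) := by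
  classical
  have hexp (i : κ) : β (b i) (b i) =
      ∑ j, ∑ l, (inner ℝ (b' j) (b i) * inner ℝ (b i) (b' l)) • β (b' j) (b' l) := by
    conv_lhs => rw [← b'.sum_repr' (b i)]
    simp only [map_sum, map_smul, LinearMap.sum_apply, LinearMap.smul_apply, Finset.smul_sum,
      smul_smul]
    rw [Finset.sum_comm]
    refine Finset.sum_congr rfl fun j _ ↦ Finset.sum_congr rfl fun l _ ↦ ?_
    rw [real_inner_comm (b i) (b' l), mul_comm]
  simp_rw [hexp]
  rw [Finset.sum_comm]
  refine Finset.sum_congr rfl fun j _ ↦ ?_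
  rw [Finset.sum_comm]
  simp_rw [← Finset.sum_smul, b.sum_inner_mul_inner, orthonormal_iff_ite.1 b'.orthonormal]
  simp

/-- The expression `∑ i j, (g(σ_ii, σ_jj) - |σ_ij|²)` does not depend on the orthonormal basis. -/
theorem sum_gauss_orthonormalBasis {κ κ' : Type*} [Fintype κ] [Fintype κ']
    (b : OrthonormalBasis κ ℝ V) (b' : OrthonormalBasis κ' ℝ V) (σ : V →ₗ[ℝ] V →ₗ[ℝ] W) :
    ∑ i, ∑ j, (inner ℝ (σ (b i) (b i)) (σ (b j) (b j)) - ‖σ (b i) (b j)‖ ^ 2) =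
      ∑ i, ∑ j, (inner ℝ (σ (b' i) (b' i)) (σ (b' j) (b' j)) - ‖σ (b' i) (b' j)‖ ^ 2) := by
  -- The norm term is a metric trace in each slot, so the basis is exchanged one slot at a time; the
  -- other term is the squared norm of the trace of `σ`.
  have h1 : ∀ z, ∑ i, ‖σ (b i) z‖ ^ 2 = ∑ i, ‖σ (b' i) z‖ ^ 2 := fun z ↦ by
    simpa [LinearMap.flip_apply] using sum_bilin_orthonormalBasis b b'
      (((innerₗ W).compl₁₂ (σ.flip z) (σ.flip z)))
  have h2 : ∀ z, ∑ i, ‖σ z (b i)‖ ^ 2 = ∑ i, ‖σ z (b' i)‖ ^ 2 := fun z ↦ by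
    simpa using sum_bilin_orthonormalBasis b b' (((innerₗ W).compl₁₂ (σ z) (σ z)))
  have h3 : ∑ i, ∑ j, ‖σ (b i) (b j)‖ ^ 2 = ∑ i, ∑ j, ‖σ (b' i) (b' j)‖ ^ 2 := by
    simp_rw [h2]
    rw [Finset.sum_comm]
    simp_rw [h1]
    rw [Finset.sum_comm]
  simp_rw [Finset.sum_sub_distrib, ← inner_sum, ← sum_inner, h3, sum_bilin_orthonormalBasis b b' σ]

/-- Extends an orthonormal family with control over the indices: `π` must occupy the first two
places and the structure vectors the last two. -/
theorem exists_orthonormalBasis_comp_eq [FiniteDimensional ℝ V] {κ κ' : Type*} [Fintype κ]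
    (hκ : Module.finrank ℝ V = Fintype.card κ) {g : κ' → V} (hg : Orthonormal ℝ g)
    {j : κ' → κ} (hj : Function.Injective j) :
    ∃ b : OrthonormalBasis κ ℝ V, ∀ a, b (j a) = g a := by
  have hv : Orthonormal ℝ ((Set.range j).domRestrict (Function.extend j g 0)) := by
    have : (Set.range j).domRestrict (Function.extend j g 0) =
        g ∘ (Equiv.ofInjective j hj).symm := by
      ext ⟨_, a, rfl⟩
      simp [hj.extend_apply]
    rw [this]
    exact hg.comp _ (Equiv.injective _)
  obtain ⟨b, hb⟩ := Orthonormal.exists_orthonormalBasis_extension_of_card_eq hκ hv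
  exact ⟨b, fun a ↦ by rw [hb _ ⟨a, rfl⟩, hj.extend_apply]⟩

/-- There is an orthonormal basis whose first vector is parallel to a given vector. -/
theorem exists_orthonormalBasis_inner_eq_zero [FiniteDimensional ℝ V] {k : ℕ}
    (hk : Module.finrank ℝ V = k) (v : V) :
    ∃ b : OrthonormalBasis (Fin k) ℝ V, ∀ r, r.val ≠ 0 → inner ℝ v (b r) = 0 := by
  by_cases hv : v = 0
  · exact ⟨(stdOrthonormalBasis ℝ V).reindex (finCongr hk), fun r _ ↦ by simp [hv]⟩
  have hk0 : 0 < k := by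
    rw [← hk]
    have := nontrivial_of_ne v 0 hv
    exact Module.finrank_pos
  obtain ⟨b, hb⟩ := exists_orthonormalBasis_comp_eq (κ := Fin k) (by simpa using hk)
    (g := fun _ : Unit ↦ ‖v‖⁻¹ • v) ⟨fun _ ↦ norm_smul_inv_norm hv, fun i j h ↦ (h rfl).elim⟩
    (j := fun _ ↦ ⟨0, hk0⟩) (fun _ _ _ ↦ rfl)
  refine ⟨b, fun r hr ↦ ?_⟩
  have h1 : v = ‖v‖ • b ⟨0, hk0⟩ := by
    rw [hb (), smul_smul, mul_inv_cancel₀ (norm_ne_zero_iff.2 hv), one_smul]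
  rw [h1, inner_smul_left, b.orthonormal.2 (fun h ↦ hr (by rw [← h])), mul_zero]

/-- The variance identity. It turns Cauchy–Schwarz into an exact sum of squares, from which equality
can be read off. -/
theorem sum_norm_sub_smul_sq {κ : Type*} [Fintype κ] (a : κ → W) (hκ : 0 < Fintype.card κ) :
    ∑ i, ‖a i - (Fintype.card κ : ℝ)⁻¹ • ∑ j, a j‖ ^ 2 =
      ∑ i, ‖a i‖ ^ 2 - (Fintype.card κ : ℝ)⁻¹ * ‖∑ j, a j‖ ^ 2 := by
  have hc : (Fintype.card κ : ℝ) ≠ 0 := by positivity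
  simp_rw [norm_sub_sq_real, Finset.sum_add_distrib, Finset.sum_sub_distrib, ← Finset.mul_sum,
    ← sum_inner]
  rw [inner_smul_right, real_inner_self_eq_norm_sq, Finset.sum_const, Finset.card_univ,
    norm_smul, nsmul_eq_mul, Real.norm_of_nonneg (by positivity)]
  field_simp
  ring

/-- The vectors `s_00 + s_11, s_22, …, s_{n+1,n+1}`. -/
def chenVector {n : ℕ} (s : Fin (n + 2) → Fin (n + 2) → W) : Fin (n + 1) → W :=
  Fin.cons (s 0 0 + s 1 1) fun k ↦ s k.succ.succ k.succ.succ

theorem sum_chenVector {n : ℕ} (s : Fin (n + 2) → Fin (n + 2) → W) :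
    ∑ k, chenVector s k = ∑ i, s i i := by
  rw [Fin.sum_univ_succ, Fin.sum_univ_succ (n := n + 1), Fin.sum_univ_succ (n := n), ← add_assoc]
  rfl

/-- The algebraic identity behind Chen's inequality. -/
theorem chen_identity {n : ℕ} (s : Fin (n + 2) → Fin (n + 2) → W) (hs : ∀ i j, s i j = s j i) :
    (n / (2 * (n + 1)) : ℝ) * ‖∑ i, s i i‖ ^ 2 -
      ((1 / 2) * ∑ i, ∑ j, (inner ℝ (s i i) (s j j) - ‖s i j‖ ^ 2) -
        (inner ℝ (s 0 0) (s 1 1) - ‖s 0 1‖ ^ 2)) =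
      (1 / 2) * ∑ k, ‖chenVector s k - ((n : ℝ) + 1)⁻¹ • ∑ i, s i i‖ ^ 2 +
        ∑ k : Fin n, (‖s 0 k.succ.succ‖ ^ 2 + ‖s 1 k.succ.succ‖ ^ 2) +
        (1 / 2) * ∑ k : Fin n, ∑ l ∈ Finset.univ.erase k, ‖s k.succ.succ l.succ.succ‖ ^ 2 := by
  have hc := sum_norm_sub_smul_sq (chenVector s) (by simp)
  rw [sum_chenVector, Fintype.card_fin, Nat.cast_add, Nat.cast_one] at hc
  rw [hc]
  -- The subtracted `inner (s 0 0) (s 1 1)` is what completes the two squares to `‖s 0 0 + s 1 1‖ ^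
  -- 2`; hence the grouping in `chenVector`.
  have h1 : ∑ k, ‖chenVector s k‖ ^ 2 = ‖s 0 0‖ ^ 2 + 2 * inner ℝ (s 0 0) (s 1 1) + ‖s 1 1‖ ^ 2 +
      ∑ k : Fin n, ‖s k.succ.succ k.succ.succ‖ ^ 2 := by
    rw [Fin.sum_univ_succ, ← norm_add_sq_real]
    rfl
  -- Split into the plane, the mixed block and the rest. After halving, `‖s 0 1‖ ^ 2` has
  -- coefficient one and cancels against the plane's contribution.
  have h2 : ∑ i, ∑ j, ‖s i j‖ ^ 2 = ‖s 0 0‖ ^ 2 + ‖s 1 1‖ ^ 2 + 2 * ‖s 0 1‖ ^ 2 +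
      2 * ∑ k : Fin n, (‖s 0 k.succ.succ‖ ^ 2 + ‖s 1 k.succ.succ‖ ^ 2) +
      (∑ k : Fin n, ‖s k.succ.succ k.succ.succ‖ ^ 2 +
        ∑ k : Fin n, ∑ l ∈ Finset.univ.erase k, ‖s k.succ.succ l.succ.succ‖ ^ 2) := by
    rw [← Finset.sum_add_distrib, Finset.sum_congr rfl fun (k : Fin n) _ ↦
      Finset.add_sum_erase Finset.univ (fun l : Fin n ↦ ‖s k.succ.succ l.succ.succ‖ ^ 2)
        (Finset.mem_univ k)]
    simp_rw [Fin.sum_univ_succ (n := n + 1), Fin.sum_univ_succ (n := n)]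
    simp_rw [Finset.sum_add_distrib, fun k : Fin n ↦ hs k.succ.succ 0,
      fun k : Fin n ↦ hs k.succ.succ (Fin.succ 0), hs (Fin.succ 0) 0]
    rw [Fin.succ_zero_eq_one]
    ring
  have h3 : ∑ i, ∑ j, inner ℝ (s i i) (s j j) = ‖∑ i, s i i‖ ^ 2 := by
    simp_rw [← inner_sum, ← sum_inner, real_inner_self_eq_norm_sq]
  simp_rw [Finset.sum_sub_distrib]
  rw [h1, h2, h3]
  have : (n : ℝ) + 1 ≠ 0 := by positivity
  field_simp
  ring

/-- The equality condition in Chen's inequality. -/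
structure IsChenIdeal {n : ℕ} (s : Fin (n + 2) → Fin (n + 2) → W) : Prop where
  zero_left : ∀ k : Fin n, s 0 k.succ.succ = 0
  one_left : ∀ k : Fin n, s 1 k.succ.succ = 0
  off_diag : ∀ k l : Fin n, l ≠ k → s k.succ.succ l.succ.succ = 0
  diag : ∀ k : Fin n, s k.succ.succ k.succ.succ = s 0 0 + s 1 1

theorem chen_le {n : ℕ} (s : Fin (n + 2) → Fin (n + 2) → W) (hs : ∀ i j, s i j = s j i) :
    (1 / 2) * ∑ i, ∑ j, (inner ℝ (s i i) (s j j) - ‖s i j‖ ^ 2) -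
        (inner ℝ (s 0 0) (s 1 1) - ‖s 0 1‖ ^ 2) ≤
      (n / (2 * (n + 1)) : ℝ) * ‖∑ i, s i i‖ ^ 2 := by
  rw [← sub_nonneg, chen_identity s hs]
  positivity

theorem chen_eq_iff {n : ℕ} (s : Fin (n + 2) → Fin (n + 2) → W) (hs : ∀ i j, s i j = s j i) :
    (1 / 2) * ∑ i, ∑ j, (inner ℝ (s i i) (s j j) - ‖s i j‖ ^ 2) -
        (inner ℝ (s 0 0) (s 1 1) - ‖s 0 1‖ ^ 2) =
      (n / (2 * (n + 1)) : ℝ) * ‖∑ i, s i i‖ ^ 2 ↔ IsChenIdeal s := by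
  rw [eq_comm, ← sub_eq_zero, chen_identity s hs]
  constructor
  · intro h
    have p1 : 0 ≤ ∑ k, ‖chenVector s k - ((n : ℝ) + 1)⁻¹ • ∑ i, s i i‖ ^ 2 := by positivity
    have p2 : 0 ≤ ∑ k : Fin n, (‖s 0 k.succ.succ‖ ^ 2 + ‖s 1 k.succ.succ‖ ^ 2) := by positivity
    have p3 : 0 ≤ ∑ k : Fin n, ∑ l ∈ Finset.univ.erase k, ‖s k.succ.succ l.succ.succ‖ ^ 2 := by
      positivity
    have z1 : ∑ k, ‖chenVector s k - ((n : ℝ) + 1)⁻¹ • ∑ i, s i i‖ ^ 2 = 0 := by linarith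
    have z2 : ∑ k : Fin n, (‖s 0 k.succ.succ‖ ^ 2 + ‖s 1 k.succ.succ‖ ^ 2) = 0 := by linarith
    have z3 : ∑ k : Fin n, ∑ l ∈ Finset.univ.erase k, ‖s k.succ.succ l.succ.succ‖ ^ 2 = 0 := by
      linarith
    rw [Finset.sum_eq_zero_iff_of_nonneg (fun _ _ ↦ by positivity)] at z1 z2 z3
    have hc (k : Fin (n + 1)) : chenVector s k = ((n : ℝ) + 1)⁻¹ • ∑ i, s i i := by
      simpa [sub_eq_zero] using z1 k (Finset.mem_univ k)
    refine ⟨fun k ↦ ?_, fun k ↦ ?_, fun k l hkl ↦ ?_, fun k ↦ ?_⟩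
    · have := z2 k (Finset.mem_univ k)
      rw [add_eq_zero_iff_of_nonneg (by positivity) (by positivity)] at this
      simpa using this.1
    · have := z2 k (Finset.mem_univ k)
      rw [add_eq_zero_iff_of_nonneg (by positivity) (by positivity)] at this
      simpa using this.2
    · have := z3 k (Finset.mem_univ k)
      rw [Finset.sum_eq_zero_iff_of_nonneg (fun _ _ ↦ by positivity)] at this
      simpa using this l (by simpa using hkl)
    -- Every entry equals the mean, and entry `0` is `s 0 0 + s 1 1`.
    · exact (hc k.succ).trans (hc 0).symm
  · intro h
    have hc (k : Fin (n + 1)) : chenVector s k = s 0 0 + s 1 1 :=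
      Fin.cases rfl (fun k ↦ h.diag k) k
    -- The `n + 1` entries coincide, so their mean is the common value.
    have z1 : ∑ i, s i i = ((n : ℝ) + 1) • (s 0 0 + s 1 1) := by
      rw [← sum_chenVector]
      simp_rw [hc]
      rw [Finset.sum_const, Finset.card_univ, Fintype.card_fin, ← Nat.cast_smul_eq_nsmul ℝ]
      push_cast
      rfl
    have z3 : ∑ k : Fin n, ∑ l ∈ Finset.univ.erase k, ‖s k.succ.succ l.succ.succ‖ ^ 2 = 0 :=
      Finset.sum_eq_zero fun k _ ↦ Finset.sum_eq_zero fun l hl ↦ by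
        rw [h.off_diag k l (Finset.ne_of_mem_erase hl)]
        simp
    rw [z1, z3, smul_smul, inv_mul_cancel₀ (by positivity)]
    simp [hc, h.zero_left, h.one_left]

/-- Lets all normal directions be treated alike, the later ones being the case `c = 0`. -/
theorem otherShapeMatrix_eq_firstShapeMatrix (k : ℕ) (a b : ℝ) :
    otherShapeMatrix k a b = firstShapeMatrix k a b 0 := by
  ext i j
  simp [otherShapeMatrix, firstShapeMatrix]

theorem one_ne_succ_succ {n : ℕ} (k : Fin n) : (1 : Fin (n + 2)) ≠ k.succ.succ := by
  rw [Ne, Fin.ext_iff]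
  simp

/-- Here `c` is the component of `s 0 0 + s 1 1` along `v`, so it vanishes as soon as `v` is
orthogonal to that single vector. -/
theorem IsChenIdeal.inner_eq_firstShapeMatrix {n : ℕ} {s : Fin (n + 2) → Fin (n + 2) → W}
    (hs : ∀ i j, s i j = s j i) (h : IsChenIdeal s) (v : W) (i j : Fin (n + 2)) :
    inner ℝ (s j i) v = firstShapeMatrix (n + 2) (inner ℝ (s 0 0) v) (inner ℝ (s 0 1) v)
      (inner ℝ (s 0 0 + s 1 1) v) i j := by
  refine Fin.cases ?_ (Fin.cases ?_ fun k ↦ ?_) i <;>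
    refine Fin.cases ?_ (Fin.cases ?_ fun l ↦ ?_) j
  · simp [firstShapeMatrix]
  · simp [firstShapeMatrix, hs 1 0]
  · simp [firstShapeMatrix, hs l.succ.succ 0, h.zero_left, (Fin.succ_ne_zero _).symm]
  · simp [firstShapeMatrix]
  · simp [firstShapeMatrix, inner_add_left]
  · simp [firstShapeMatrix, hs l.succ.succ 1, h.one_left, one_ne_succ_succ]
  · simp [firstShapeMatrix, h.zero_left]
  · simp [firstShapeMatrix, h.one_left, (one_ne_succ_succ _).symm]
  · by_cases hkl : k = l
    · simp [firstShapeMatrix, hkl, h.diag]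
    · simp [firstShapeMatrix, hkl, h.off_diag l k hkl]

/-- Each condition says that a vector of `U` is zero, which is tested against the basis `ν`. The
numbers `a`, `b`, `c` may vary with `r`. -/
theorem isChenIdeal_of_inner_eq_firstShapeMatrix {n : ℕ} {s : Fin (n + 2) → Fin (n + 2) → W}
    {U : Submodule ℝ W} (hU : ∀ i j, s i j ∈ U) {κ : Type*} [Fintype κ]
    (ν : OrthonormalBasis κ ℝ U)
    (h : ∀ r, ∃ a b c, ∀ i j, inner ℝ (s j i) (ν r : W) = firstShapeMatrix (n + 2) a b c i j) :
    IsChenIdeal s := by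
  have ext_zero {w : W} (hw : w ∈ U) (h0 : ∀ r, inner ℝ w (ν r : W) = 0) : w = 0 := by
    have : (⟨w, hw⟩ : U) = 0 := by
      rw [← ν.sum_repr' ⟨w, hw⟩]
      refine Finset.sum_eq_zero fun r _ ↦ ?_
      rw [real_inner_comm, show inner ℝ (⟨w, hw⟩ : U) (ν r) = 0 from h0 r, zero_smul]
    exact congrArg Subtype.val this
  refine ⟨fun k ↦ ?_, fun k ↦ ?_, fun k l hkl ↦ ?_, fun k ↦ ?_⟩
  · refine ext_zero (hU _ _) fun r ↦ ?_
    obtain ⟨a, b, c, hr⟩ := h r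
    rw [hr]
    simp [firstShapeMatrix]
  · refine ext_zero (hU _ _) fun r ↦ ?_
    obtain ⟨a, b, c, hr⟩ := h r
    rw [hr]
    simp [firstShapeMatrix, (one_ne_succ_succ _).symm]
  · refine ext_zero (hU _ _) fun r ↦ ?_
    obtain ⟨a, b, c, hr⟩ := h r
    rw [hr]
    simp [firstShapeMatrix, hkl]
  · refine sub_eq_zero.1 (ext_zero (U.sub_mem (hU _ _) (U.add_mem (hU _ _) (hU _ _))) fun r ↦ ?_)
    obtain ⟨a, b, c, hr⟩ := h r
    rw [inner_sub_left, inner_add_left, hr, hr, hr]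
    simp [firstShapeMatrix]

end LinearAlgebra

/-! ## The ambient curvature along a tangent space -/

section AmbientCurvature

variable {V : Type*} [NormedAddCommGroup V] [InnerProductSpace ℝ V]

/-- The value `g(R(X, Y)Y, X)` of the curvature tensor of a generalized `S`-space-form on a tangent
subspace, where `T` is the tangential part of `f` and `z` are the structure vectors. -/
def ambientCurvature (T : V →ₗ[ℝ] V) (z : Fin 2 → V) (F₁ F₂ F₃ : ℝ) (F : Fin 2 → Fin 2 → ℝ)
    (X Y : V) : ℝ :=
  F₁ * (‖X‖ ^ 2 * ‖Y‖ ^ 2 - inner ℝ X Y ^ 2) + 3 * F₂ * inner ℝ X (T Y) ^ 2 +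
    F₃ * (inner ℝ (z 0) X * inner ℝ (z 1) Y - inner ℝ (z 1) X * inner ℝ (z 0) Y) ^ 2 +
    ∑ i, ∑ j, F i j * (inner ℝ (z i) X * inner ℝ (z j) Y * inner ℝ X Y -
      inner ℝ (z i) Y * inner ℝ (z j) Y * ‖X‖ ^ 2 + inner ℝ X Y * inner ℝ (z i) Y * inner ℝ (z j) X
      - ‖Y‖ ^ 2 * inner ℝ (z i) X * inner ℝ (z j) X)

variable {T : V →ₗ[ℝ] V} {z : Fin 2 → V} {F₁ F₂ F₃ : ℝ} {F : Fin 2 → Fin 2 → ℝ}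

/-- Allows the diagonal terms to be added to the sum over `i ≠ j` in the scalar curvature. -/
theorem ambientCurvature_self (hT : ∀ X Y, inner ℝ X (T Y) = -inner ℝ (T X) Y) (X : V) :
    ambientCurvature T z F₁ F₂ F₃ F X X = 0 := by
  have h : inner ℝ X (T X) = 0 := by
    have h1 := hT X X
    have h2 : inner ℝ (T X) X = inner ℝ X (T X) := real_inner_comm _ _
    linarith
  have h2 (i j : Fin 2) : inner ℝ (z i) X * inner ℝ (z j) X * ‖X‖ ^ 2 -
      inner ℝ (z i) X * inner ℝ (z j) X * ‖X‖ ^ 2 + ‖X‖ ^ 2 * inner ℝ (z i) X * inner ℝ (z j) X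
      - ‖X‖ ^ 2 * inner ℝ (z i) X * inner ℝ (z j) X = 0 := by ring
  simp only [ambientCurvature, h, real_inner_self_eq_norm_sq, h2]
  simp
  ring_nf

/-- Only inner products enter the expression, so it pulls back along the differential, with `T` and
the tangent lifts `z` in place of `f` and `ξ`. -/
theorem ambientCurvature_map {W : Type*} [NormedAddCommGroup W] [InnerProductSpace ℝ W]
    (L : V → W) {f : W →ₗ[ℝ] W} {ξ : Fin 2 → W} (hL : ∀ X Y, inner ℝ (L X) (L Y) = inner ℝ X Y)
    (hf : ∀ X Y, inner ℝ (L X) (f (L Y)) = inner ℝ X (T Y))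
    (hξ : ∀ α X, inner ℝ (ξ α) (L X) = inner ℝ (z α) X) (X Y : V) :
    ambientCurvature f ξ F₁ F₂ F₃ F (L X) (L Y) = ambientCurvature T z F₁ F₂ F₃ F X Y := by
  simp only [ambientCurvature, ← real_inner_self_eq_norm_sq, hL, hf, hξ]

theorem ambientCurvature_of_orthogonal {X Y : V} (hX : ‖X‖ = 1) (hY : ‖Y‖ = 1)
    (hXY : inner ℝ X Y = 0) (hzX : ∀ α, inner ℝ (z α) X = 0) (hzY : ∀ α, inner ℝ (z α) Y = 0) :
    ambientCurvature T z F₁ F₂ F₃ F X Y = F₁ + 3 * F₂ * inner ℝ X (T Y) ^ 2 := by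
  simp [ambientCurvature, hX, hY, hXY, hzX, hzY]

/-- Parseval in both indices. The terms in `F 0 1` and `F 1 0` drop out because the structure
vectors are orthogonal. -/
theorem sum_ambientCurvature {κ : Type*} [Fintype κ] (b : OrthonormalBasis κ ℝ V)
    (hz : Orthonormal ℝ z) :
    ∑ i, ∑ j, ambientCurvature T z F₁ F₂ F₃ F (b i) (b j) =
      Fintype.card κ * (Fintype.card κ - 1) * F₁ +
      3 * F₂ * ∑ i, ∑ j, inner ℝ (b i) (T (b j)) ^ 2 + 2 * F₃ -
      2 * (Fintype.card κ - 1) * (F 0 0 + F 1 1) := by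
  classical
  have hzz (α β : Fin 2) : ∑ i, inner ℝ (z α) (b i) * inner ℝ (z β) (b i) =
      if α = β then 1 else 0 := by
    rw [← orthonormal_iff_ite.1 hz, ← b.sum_inner_mul_inner]
    exact Finset.sum_congr rfl fun i _ ↦ by rw [real_inner_comm (b i) (z β)]
  have hb := orthonormal_iff_ite.1 b.orthonormal
  have s1 : ∑ i, ∑ j, F₁ * (‖b i‖ ^ 2 * ‖b j‖ ^ 2 - inner ℝ (b i) (b j) ^ 2) =
      Fintype.card κ * (Fintype.card κ - 1) * F₁ := by
    simp [hb, ← Finset.mul_sum]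
    ring
  have s3 : ∑ i, ∑ j, F₃ * (inner ℝ (z 0) (b i) * inner ℝ (z 1) (b j) -
      inner ℝ (z 1) (b i) * inner ℝ (z 0) (b j)) ^ 2 = 2 * F₃ := by
    -- Each product separates into a factor in `i` and one in `j`; the sum is twice the Gram
    -- determinant of `z`, which is `1`.
    have e (i j : κ) : F₃ * (inner ℝ (z 0) (b i) * inner ℝ (z 1) (b j) -
        inner ℝ (z 1) (b i) * inner ℝ (z 0) (b j)) ^ 2 =
        F₃ * ((inner ℝ (z 0) (b i) * inner ℝ (z 0) (b i)) *
          (inner ℝ (z 1) (b j) * inner ℝ (z 1) (b j)) -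
        2 * ((inner ℝ (z 0) (b i) * inner ℝ (z 1) (b i)) *
          (inner ℝ (z 0) (b j) * inner ℝ (z 1) (b j))) +
        (inner ℝ (z 1) (b i) * inner ℝ (z 1) (b i)) *
          (inner ℝ (z 0) (b j) * inner ℝ (z 0) (b j))) := by ring
    simp_rw [e, ← Finset.mul_sum, Finset.sum_add_distrib, Finset.sum_sub_distrib, ← Finset.mul_sum,
      ← Finset.sum_mul, hzz]
    simp
    ring
  have s4 (α β : Fin 2) : ∑ i, ∑ j, F α β * (inner ℝ (z α) (b i) * inner ℝ (z β) (b j) *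
      inner ℝ (b i) (b j) - inner ℝ (z α) (b j) * inner ℝ (z β) (b j) * ‖b i‖ ^ 2 +
      inner ℝ (b i) (b j) * inner ℝ (z α) (b j) * inner ℝ (z β) (b i)
      - ‖b j‖ ^ 2 * inner ℝ (z α) (b i) * inner ℝ (z β) (b i)) =
      F α β * (2 * (1 - Fintype.card κ) * if α = β then 1 else 0) := by
    simp_rw [← Finset.mul_sum, Finset.sum_sub_distrib, Finset.sum_add_distrib,
      Finset.sum_sub_distrib, hb, b.orthonormal.1, mul_ite, ite_mul]
    simp [hzz, ← Finset.mul_sum]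
    split_ifs <;> ring
  simp only [ambientCurvature, Finset.sum_add_distrib, s1, s3]
  have s5 : ∑ i, ∑ j, ∑ α, ∑ β, F α β * (inner ℝ (z α) (b i) * inner ℝ (z β) (b j) *
      inner ℝ (b i) (b j) - inner ℝ (z α) (b j) * inner ℝ (z β) (b j) * ‖b i‖ ^ 2 +
      inner ℝ (b i) (b j) * inner ℝ (z α) (b j) * inner ℝ (z β) (b i)
      - ‖b j‖ ^ 2 * inner ℝ (z α) (b i) * inner ℝ (z β) (b i)) =
      - (2 * (Fintype.card κ - 1) * (F 0 0 + F 1 1)) := by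
    simp only [Fin.sum_univ_two, Finset.sum_add_distrib, s4]
    simp
    ring
  rw [s5]
  simp_rw [← Finset.mul_sum]
  ring

/-- The square norm of an antisymmetric operator with values in a subspace can be computed in
that subspace. -/
theorem sum_inner_sq_subspace {U : Submodule ℝ V} {κ κ' : Type*} [Fintype κ] [Fintype κ']
    (b : OrthonormalBasis κ ℝ V) (c : OrthonormalBasis κ' ℝ U)
    (hT : ∀ X Y, inner ℝ X (T Y) = -inner ℝ (T X) Y) (hU : ∀ X, T X ∈ U) :
    ∑ i, ∑ j, inner ℝ (c i : V) (T (c j)) ^ 2 = ∑ i, ∑ j, inner ℝ (b i) (T (b j)) ^ 2 := by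
  have hc (w : V) (hw : w ∈ U) : ∑ i, inner ℝ (c i : V) w ^ 2 = ‖w‖ ^ 2 :=
    c.sum_sq_inner_right ⟨w, hw⟩
  -- Since `T` has values in `U`, the inner sum is `‖T (c j)‖ ^ 2` over either basis. Antisymmetry
  -- moves `T` to the other slot, where the same exchange is repeated.
  rw [Finset.sum_comm]
  simp_rw [hc _ (hU _), ← b.sum_sq_inner_right]
  rw [Finset.sum_comm]
  simp_rw [hT, neg_sq, real_inner_comm (c _ : V), hc _ (hU _), ← b.sum_sq_inner_left]

end AmbientCurvature

/-! ### Metric `f`-structures and the tangential part of `f`. -/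

section Submanifold

set_option linter.unusedSectionVars false

variable {m : ℕ} {N : Type*} [TopologicalSpace N]
  [ChartedSpace (EuclideanSpace ℝ (Fin (2 * m + 2))) N] [IsManifold (𝓡 (2 * m + 2)) ∞ N]
  [RiemannianBundle (fun x : N ↦ TangentSpace (𝓡 (2 * m + 2)) x)]

namespace MetricFStructure

variable (S : MetricFStructure m 2 N) (x : N)

theorem inner_ξ (α : Fin 2) (X : TangentSpace (𝓡 (2 * m + 2)) x) :
    inner ℝ (S.ξ α x) X = S.η α x X := by
  rw [S.inner_eq, S.f_ξ, inner_zero_left, zero_add]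
  simp [S.η_ξ]

theorem orthonormal_ξ : Orthonormal ℝ fun α ↦ S.ξ α x := by
  rw [orthonormal_iff_ite]
  intro α β
  rw [S.inner_ξ, S.η_ξ]

/-- Metric compatibility applied to `X` and `f Y`: the forms `η` kill the image of `f`, and so do
the `ξ`-terms of `f (f Y)` when paired with `f X`. -/
theorem inner_f_right (X Y : TangentSpace (𝓡 (2 * m + 2)) x) :
    inner ℝ X (S.f x Y) = -inner ℝ (S.f x X) Y := by
  rw [S.inner_eq x X, S.f_sq, inner_add_right, inner_neg_right, inner_sum]
  simp [S.η_f, inner_smul_right, real_inner_comm, S.inner_ξ]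

variable {S x} in
-- In the `F₂` term the first and last summands of `tensorR₂` give `1 + 2 = 3` times the square; the
-- middle one vanishes by antisymmetry of `f`.
theorem IsGeneralizedSSpaceForm.inner_curvature {F₁ F₂ F₃ F₁₁ F₁₂ F₂₁ F₂₂ : N → ℝ}
    (hN : S.IsGeneralizedSSpaceForm F₁ F₂ F₃ F₁₁ F₁₂ F₂₁ F₂₂)
    (X Y : TangentSpace (𝓡 (2 * m + 2)) x) :
    inner ℝ (curvature x X Y Y) X =
      ambientCurvature (S.f x : TangentSpace (𝓡 (2 * m + 2)) x →ₗ[ℝ] _) (fun α ↦ S.ξ α x)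
        (F₁ x) (F₂ x) (F₃ x) ![![F₁₁ x, F₁₂ x], ![F₂₁ x, F₂₂ x]] X Y := by
  have hff : inner ℝ Y (S.f x Y) = 0 := by
    have h1 := S.inner_f_right x Y Y
    have h2 : inner ℝ (S.f x Y) Y = inner ℝ Y (S.f x Y) := real_inner_comm _ _
    linarith
  have hfX : inner ℝ (S.f x X) X = 0 := by
    have h1 := S.inner_f_right x X X
    have h2 : inner ℝ (S.f x X) X = inner ℝ X (S.f x X) := real_inner_comm _ _
    linarith
  have hYX : inner ℝ Y X = inner ℝ X Y := real_inner_comm _ _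
  have hfY : inner ℝ (S.f x Y) X = inner ℝ X (S.f x Y) := real_inner_comm _ _
  rw [hN.curvature_eq]
  simp only [tensorR₁, tensorR₂, tensorR₃, tensorRij, inner_add_left, inner_sub_left,
    real_inner_smul_left, S.inner_ξ, ambientCurvature, Fin.sum_univ_two, hff, hfX, hYX, hfY,
    real_inner_self_eq_norm_sq, ContinuousLinearMap.coe_coe]
  simp
  ring

end MetricFStructure

variable {n : ℕ} {M : Type*} [TopologicalSpace M]
  [ChartedSpace (EuclideanSpace ℝ (Fin (n + 2))) M] [IsManifold (𝓡 (n + 2)) ∞ M]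
  [RiemannianBundle (fun x : M ↦ TangentSpace (𝓡 (n + 2)) x)]

namespace MetricFStructure

variable (S : MetricFStructure m 2 N) (ι : M → N) (p : M)

theorem inner_tangentialPart (X Y : TangentSpace (𝓡 (n + 2)) p) :
    inner ℝ X (S.tangentialPart n ι p Y) =
      inner ℝ (mfderiv (𝓡 (n + 2)) (𝓡 (2 * m + 2)) ι p X)
        (S.f (ι p) (mfderiv (𝓡 (n + 2)) (𝓡 (2 * m + 2)) ι p Y)) := by
  exact LinearMap.adjoint_inner_right
    (mfderiv (𝓡 (n + 2)) (𝓡 (2 * m + 2)) ι p :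
      TangentSpace (𝓡 (n + 2)) p →ₗ[ℝ] TangentSpace (𝓡 (2 * m + 2)) (ι p)) X
    (S.f (ι p) (mfderiv (𝓡 (n + 2)) (𝓡 (2 * m + 2)) ι p Y))

theorem inner_tangentialPart_right (X Y : TangentSpace (𝓡 (n + 2)) p) :
    inner ℝ X (S.tangentialPart n ι p Y) = -inner ℝ (S.tangentialPart n ι p X) Y := by
  rw [real_inner_comm Y, inner_tangentialPart, inner_tangentialPart, S.inner_f_right,
    real_inner_comm (S.f (ι p) _)]

variable {S ι p}

theorem mem_distL_iff (X : TangentSpace (𝓡 (n + 2)) p) :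
    X ∈ S.distL n ι p ↔ ∀ α, inner ℝ (S.ξ α (ι p))
      (mfderiv (𝓡 (n + 2)) (𝓡 (2 * m + 2)) ι p X) = 0 := by
  rw [distL, Submodule.mem_comap, Submodule.mem_orthogonal]
  constructor
  · exact fun h α ↦ h _ (Submodule.subset_span ⟨α, rfl⟩)
  · intro h u hu
    induction hu using Submodule.span_induction with
    | mem u hu => obtain ⟨α, rfl⟩ := hu; exact h α
    | zero => exact inner_zero_left _
    | add u v _ _ hu hv => rw [inner_add_left, hu, hv, add_zero]
    | smul c u _ hu => rw [inner_smul_left, hu, mul_zero]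

/-- Against a structure vector, `T X` pairs to `η (f X) = 0`. Hence `‖T‖²` can be summed over a
basis of the whole tangent space. -/
theorem tangentialPart_mem_distL (X : TangentSpace (𝓡 (n + 2)) p)
    (hξ : S.IsTangent n ι) (hι : IsIsometricImmersion (n + 2) (2 * m + 2) ι) :
    S.tangentialPart n ι p X ∈ S.distL n ι p := by
  rw [mem_distL_iff]
  intro α
  obtain ⟨z, hz⟩ := hξ p α
  have hz : mfderiv (𝓡 (n + 2)) (𝓡 (2 * m + 2)) ι p z = S.ξ α (ι p) := hz
  rw [← hz, hι.inner_mfderiv, inner_tangentialPart, hz, S.inner_ξ, S.η_f]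

theorem normSqT_eq_sum (hξ : S.IsTangent n ι) (hι : IsIsometricImmersion (n + 2) (2 * m + 2) ι)
    {κ : Type*} [Fintype κ] (b : OrthonormalBasis κ ℝ (TangentSpace (𝓡 (n + 2)) p)) :
    S.normSqT n ι p = ∑ i, ∑ j, inner ℝ (b i) (S.tangentialPart n ι p (b j)) ^ 2 :=
  sum_inner_sq_subspace b _ (S.inner_tangentialPart_right ι p)
    fun X ↦ tangentialPart_mem_distL X hξ hι

end MetricFStructure

end Submanifold

/-! ## Scalar and plane curvature of the submanifold -/

section Intrinsic

set_option linter.unusedSectionVars false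

variable {m : ℕ} {N : Type*} [TopologicalSpace N]
  [ChartedSpace (EuclideanSpace ℝ (Fin (2 * m + 2))) N] [IsManifold (𝓡 (2 * m + 2)) ∞ N]
  [RiemannianBundle (fun x : N ↦ TangentSpace (𝓡 (2 * m + 2)) x)]
  [IsContMDiffRiemannianBundle (𝓡 (2 * m + 2)) ∞ (EuclideanSpace ℝ (Fin (2 * m + 2)))
      (fun x : N ↦ TangentSpace (𝓡 (2 * m + 2)) x)]
  {n : ℕ} {M : Type*} [TopologicalSpace M]
  [ChartedSpace (EuclideanSpace ℝ (Fin (n + 2))) M] [IsManifold (𝓡 (n + 2)) ∞ M]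
  [RiemannianBundle (fun x : M ↦ TangentSpace (𝓡 (n + 2)) x)]
  [IsContMDiffRiemannianBundle (𝓡 (n + 2)) ∞ (EuclideanSpace ℝ (Fin (n + 2)))
      (fun x : M ↦ TangentSpace (𝓡 (n + 2)) x)]
  {S : MetricFStructure m 2 N} {F₁ F₂ F₃ F₁₁ F₁₂ F₂₁ F₂₂ : N → ℝ} {ι : M → N}

theorem inner_curvature_submanifold
    (hN : S.IsGeneralizedSSpaceForm F₁ F₂ F₃ F₁₁ F₁₂ F₂₁ F₂₂)
    (hι : IsIsometricImmersion (n + 2) (2 * m + 2) ι) (p : M)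
    {z : Fin 2 → TangentSpace (𝓡 (n + 2)) p}
    (hz : ∀ α, mfderiv (𝓡 (n + 2)) (𝓡 (2 * m + 2)) ι p (z α) = S.ξ α (ι p))
    (X Y : TangentSpace (𝓡 (n + 2)) p) :
    inner ℝ (curvature p X Y Y) X =
      ambientCurvature (S.tangentialPart n ι p) z (F₁ (ι p)) (F₂ (ι p)) (F₃ (ι p))
        ![![F₁₁ (ι p), F₁₂ (ι p)], ![F₂₁ (ι p), F₂₂ (ι p)]] X Y +
      (inner ℝ (secondFundamentalForm (n + 2) (2 * m + 2) ι p X X)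
        (secondFundamentalForm (n + 2) (2 * m + 2) ι p Y Y) -
      ‖secondFundamentalForm (n + 2) (2 * m + 2) ι p X Y‖ ^ 2) := by
  rw [gauss_equation hι, hN.inner_curvature, secondFundamentalForm_comm hι p Y X,
    real_inner_self_eq_norm_sq, real_inner_comm (secondFundamentalForm _ _ ι p X X),
    ambientCurvature_map (T := S.tangentialPart n ι p) (z := z)
      (mfderiv (𝓡 (n + 2)) (𝓡 (2 * m + 2)) ι p) (hι.inner_mfderiv p)
      (fun X Y ↦ (S.inner_tangentialPart ι p X Y).symm)
      (fun α X ↦ by rw [← hz α, hι.inner_mfderiv])]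
  ring

theorem sectionalCurvature_of_orthonormal {p : M} {X Y : TangentSpace (𝓡 (n + 2)) p}
    (hX : ‖X‖ = 1) (hY : ‖Y‖ = 1) (hXY : inner ℝ X Y = 0) :
    sectionalCurvature p X Y = inner ℝ (curvature p X Y Y) X := by
  simp [sectionalCurvature, hX, hY, hXY]

variable (n m) in
/-- The second fundamental form as a bilinear map. -/
def secondFundamentalFormₗ (ι : M → N) (p : M) : TangentSpace (𝓡 (n + 2)) p →ₗ[ℝ]
    TangentSpace (𝓡 (n + 2)) p →ₗ[ℝ] TangentSpace (𝓡 (2 * m + 2)) (ι p) :=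
  LinearMap.mk₂ ℝ (fun X Y ↦ secondFundamentalForm (n + 2) (2 * m + 2) ι p X Y)
    (fun X X' Y ↦ by rw [map_add, add_apply]) (fun c X Y ↦ by rw [map_smul, smul_apply])
    (fun X Y Y' ↦ map_add _ _ _) (fun c X Y ↦ map_smul _ _ _)

theorem secondFundamentalFormₗ_apply (ι : M → N) (p : M) (X Y : TangentSpace (𝓡 (n + 2)) p) :
    secondFundamentalFormₗ m n ι p X Y = secondFundamentalForm (n + 2) (2 * m + 2) ι p X Y := rfl

theorem finrank_tangentSpace {d : ℕ} {M : Type*} [TopologicalSpace M]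
    [ChartedSpace (EuclideanSpace ℝ (Fin d)) M] (p : M) :
    Module.finrank ℝ (TangentSpace (𝓡 d) p) = d :=
  finrank_euclideanSpace_fin (𝕜 := ℝ) (n := d)

theorem sum_sum_erase {κ : Type*} [Fintype κ] [DecidableEq κ] {A B : κ → κ → ℝ}
    (h0 : ∀ i, B i i = 0) (h : ∀ i j, i ≠ j → A i j = B i j) :
    ∑ i, ∑ j ∈ Finset.univ.erase i, A i j = ∑ i, ∑ j, B i j := by
  refine Finset.sum_congr rfl fun i _ ↦ ?_
  rw [← Finset.add_sum_erase _ _ (Finset.mem_univ i), h0, zero_add]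
  exact Finset.sum_congr rfl fun j hj ↦ h i j (Finset.ne_of_mem_erase hj).symm

/-- The ambient part is evaluated in the standard basis; the part in `σ` is transferred to `e`,
which can therefore be adapted to the plane. -/
theorem scalarCurvature_eq
    (hN : S.IsGeneralizedSSpaceForm F₁ F₂ F₃ F₁₁ F₁₂ F₂₁ F₂₂)
    (hι : IsIsometricImmersion (n + 2) (2 * m + 2) ι) (hξ : S.IsTangent n ι) (p : M)
    {κ : Type*} [Fintype κ] (e : OrthonormalBasis κ ℝ (TangentSpace (𝓡 (n + 2)) p)) :
    scalarCurvature (n + 2) p =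
      ((n : ℝ) + 2) * ((n : ℝ) + 1) / 2 * F₁ (ι p) + 3 * F₂ (ι p) * (S.normSqT n ι p / 2) +
      F₃ (ι p) - ((n : ℝ) + 1) * (F₁₁ (ι p) + F₂₂ (ι p)) +
      (1 / 2) * ∑ i, ∑ j, (inner ℝ (secondFundamentalForm (n + 2) (2 * m + 2) ι p (e i) (e i))
        (secondFundamentalForm (n + 2) (2 * m + 2) ι p (e j) (e j)) -
        ‖secondFundamentalForm (n + 2) (2 * m + 2) ι p (e i) (e j)‖ ^ 2) := by
  choose z hz using hξ p
  have hz (α : Fin 2) : mfderiv (𝓡 (n + 2)) (𝓡 (2 * m + 2)) ι p (z α) = S.ξ α (ι p) := hz α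
  have hzo : Orthonormal ℝ z := by
    rw [orthonormal_iff_ite]
    intro α β
    rw [← hι.inner_mfderiv, hz, hz, orthonormal_iff_ite.1 (S.orthonormal_ξ (ι p))]
  set b := stdOrthonormalBasis ℝ (TangentSpace (𝓡 (n + 2)) p) with hb
  have h0 (X) : ambientCurvature (S.tangentialPart n ι p) z (F₁ (ι p)) (F₂ (ι p)) (F₃ (ι p))
        ![![F₁₁ (ι p), F₁₂ (ι p)], ![F₂₁ (ι p), F₂₂ (ι p)]] X X = 0 :=
    ambientCurvature_self (V := TangentSpace (𝓡 (n + 2)) p) (S.inner_tangentialPart_right ι p) X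
  have hsum : ∑ i, ∑ j ∈ Finset.univ.erase i, sectionalCurvature p (b i) (b j) = ∑ i, ∑ j,
      (ambientCurvature (S.tangentialPart n ι p) z (F₁ (ι p)) (F₂ (ι p)) (F₃ (ι p))
        ![![F₁₁ (ι p), F₁₂ (ι p)], ![F₂₁ (ι p), F₂₂ (ι p)]] (b i) (b j) +
      (inner ℝ (secondFundamentalForm (n + 2) (2 * m + 2) ι p (b i) (b i))
        (secondFundamentalForm (n + 2) (2 * m + 2) ι p (b j) (b j)) -
      ‖secondFundamentalForm (n + 2) (2 * m + 2) ι p (b i) (b j)‖ ^ 2)) := by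
    refine sum_sum_erase (fun i ↦ ?_) fun i j h ↦ ?_
    · rw [h0, real_inner_self_eq_norm_sq, sub_self, add_zero]
    · rw [sectionalCurvature_of_orthonormal (b.orthonormal.1 i) (b.orthonormal.1 j)
        (b.orthonormal.2 h), inner_curvature_submanifold hN hι p hz]
  have hσ := sum_gauss_orthonormalBasis b e (secondFundamentalFormₗ m n ι p)
  simp only [secondFundamentalFormₗ_apply] at hσ
  have hcard : (Fintype.card (Fin (Module.finrank ℝ (TangentSpace (𝓡 (n + 2)) p))) : ℝ) =
      n + 2 := by
    rw [Fintype.card_fin, finrank_tangentSpace]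
    push_cast
    rfl
  rw [scalarCurvature, ← hb, hsum]
  simp_rw [Finset.sum_add_distrib]
  rw [hσ, sum_ambientCurvature b hzo, S.normSqT_eq_sum hξ hι b, hcard]
  simp only [Matrix.cons_val_zero, Matrix.cons_val_one]
  ring

theorem planeCurvature_eq
    (hN : S.IsGeneralizedSSpaceForm F₁ F₂ F₃ F₁₁ F₁₂ F₂₁ F₂₂)
    (hι : IsIsometricImmersion (n + 2) (2 * m + 2) ι) (hξ : S.IsTangent n ι) (p : M)
    (P : Submodule ℝ (TangentSpace (𝓡 (n + 2)) p)) (hP : Module.finrank ℝ P = 2)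
    (hPL : P ≤ S.distL n ι p) {X Y : TangentSpace (𝓡 (n + 2)) p} (hX : ‖X‖ = 1) (hY : ‖Y‖ = 1)
    (hXY : inner ℝ X Y = 0) (hXP : X ∈ P) (hYP : Y ∈ P) :
    planeCurvature P hP = F₁ (ι p) + 3 * F₂ (ι p) * S.planeFSq ι P hP +
      (inner ℝ (secondFundamentalForm (n + 2) (2 * m + 2) ι p X X)
        (secondFundamentalForm (n + 2) (2 * m + 2) ι p Y Y) -
      ‖secondFundamentalForm (n + 2) (2 * m + 2) ι p X Y‖ ^ 2) := by
  choose z hz using hξ p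
  have hz (α : Fin 2) : mfderiv (𝓡 (n + 2)) (𝓡 (2 * m + 2)) ι p (z α) = S.ξ α (ι p) := hz α
  have hzP (α : Fin 2) {X} (hX : X ∈ P) : inner ℝ (z α) X = 0 := by
    rw [← hι.inner_mfderiv, hz]
    exact (MetricFStructure.mem_distL_iff X).1 (hPL hX) α
  obtain ⟨c, hc⟩ := exists_orthonormalBasis_comp_eq (V := P) (κ := Fin 2) (by simpa using hP)
    (g := ![⟨X, hXP⟩, ⟨Y, hYP⟩]) (j := id) (by
      rw [orthonormal_iff_ite]
      have hYX : inner ℝ Y X = 0 := by rw [real_inner_comm, hXY]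
      intro i j
      fin_cases i <;> fin_cases j <;>
        simp [hX, hY, hXY, hYX]) Function.injective_id
  have hc0 : (c 0 : TangentSpace (𝓡 (n + 2)) p) = X := congrArg Subtype.val (hc 0)
  have hc1 : (c 1 : TangentSpace (𝓡 (n + 2)) p) = Y := congrArg Subtype.val (hc 1)
  -- For a two-element basis the diagonal terms vanish and the off-diagonal one appears twice, so
  -- the `σ` part is the same for `X`, `Y` as for `planeBasis`.
  have hσ := sum_gauss_orthonormalBasis c (planeBasis P hP)
    ((secondFundamentalFormₗ m n ι p).compl₁₂ P.subtype P.subtype)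
  simp only [Fin.sum_univ_two, LinearMap.compl₁₂_apply, Submodule.subtype_apply, hc0, hc1,
    secondFundamentalFormₗ_apply, real_inner_self_eq_norm_sq, sub_self] at hσ
  set q := planeBasis P hP with hq
  have hσ' : inner ℝ (secondFundamentalForm (n + 2) (2 * m + 2) ι p X X)
        (secondFundamentalForm (n + 2) (2 * m + 2) ι p Y Y) -
      ‖secondFundamentalForm (n + 2) (2 * m + 2) ι p X Y‖ ^ 2 =
      inner ℝ (secondFundamentalForm (n + 2) (2 * m + 2) ι p (q 0) (q 0))
        (secondFundamentalForm (n + 2) (2 * m + 2) ι p (q 1) (q 1)) -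
      ‖secondFundamentalForm (n + 2) (2 * m + 2) ι p (q 0) (q 1)‖ ^ 2 := by
    rw [secondFundamentalForm_comm hι p Y X, secondFundamentalForm_comm hι p (q 1) (q 0),
      real_inner_comm (secondFundamentalForm (n + 2) (2 * m + 2) ι p X X),
      real_inner_comm (secondFundamentalForm (n + 2) (2 * m + 2) ι p (q 0) (q 0))] at hσ
    linarith
  have hq0 : ‖(q 0 : TangentSpace (𝓡 (n + 2)) p)‖ = 1 := q.orthonormal.1 0
  have hq1 : ‖(q 1 : TangentSpace (𝓡 (n + 2)) p)‖ = 1 := q.orthonormal.1 1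
  have hq01 : inner ℝ (q 0 : TangentSpace (𝓡 (n + 2)) p) (q 1) = 0 :=
    q.orthonormal.2 (by decide : (0 : Fin 2) ≠ 1)
  rw [planeCurvature, ← hq, sectionalCurvature_of_orthonormal hq0 hq1 hq01,
    inner_curvature_submanifold hN hι p hz, ambientCurvature_of_orthogonal hq0 hq1 hq01
      (fun α ↦ hzP α (q 0).2) (fun α ↦ hzP α (q 1).2), hσ', MetricFStructure.planeFSq, ← hq,
    S.inner_tangentialPart]

theorem finrank_normalSpace (hι : IsIsometricImmersion (n + 2) (2 * m + 2) ι) (p : M) :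
    Module.finrank ℝ (normalSpace (n + 2) (2 * m + 2) ι p) = 2 * m - n := by
  have hinj : Function.Injective (mfderiv (𝓡 (n + 2)) (𝓡 (2 * m + 2)) ι p :
      TangentSpace (𝓡 (n + 2)) p →ₗ[ℝ] TangentSpace (𝓡 (2 * m + 2)) (ι p)) := by
    refine (injective_iff_map_eq_zero _).2 fun X hX ↦ ?_
    have hX : mfderiv (𝓡 (n + 2)) (𝓡 (2 * m + 2)) ι p X = 0 := hX
    rw [← inner_self_eq_zero (𝕜 := ℝ), ← hι.inner_mfderiv, hX, inner_zero_left]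
  have h1 := LinearMap.finrank_range_of_inj hinj
  have h2 := Submodule.finrank_add_finrank_orthogonal (LinearMap.range
    (mfderiv (𝓡 (n + 2)) (𝓡 (2 * m + 2)) ι p :
      TangentSpace (𝓡 (n + 2)) p →ₗ[ℝ] TangentSpace (𝓡 (2 * m + 2)) (ι p)))
  rw [h1, finrank_tangentSpace, finrank_tangentSpace] at h2
  have h3 : Module.finrank ℝ (normalSpace (n + 2) (2 * m + 2) ι p) = _ := rfl
  rw [h3, normalSpace]
  -- The dimension count in `h2` gives `n ≤ 2 * m`, so the subtraction is not truncated.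
  omega

theorem secondFundamentalForm_mem_normalSpace
    (hι : IsIsometricImmersion (n + 2) (2 * m + 2) ι) (p : M) (X Y : TangentSpace (𝓡 (n + 2)) p) :
    secondFundamentalForm (n + 2) (2 * m + 2) ι p X Y ∈ normalSpace (n + 2) (2 * m + 2) ι p := by
  rw [normalSpace, Submodule.mem_orthogonal']
  rintro _ ⟨Z, rfl⟩
  exact inner_secondFundamentalForm_mfderiv hι p X Y Z

/-- Column `j` holds the coordinates of the image of `e j`, whence the order of the indices. -/
theorem toMatrix_shapeOperator {κ : Type*} [Fintype κ] [DecidableEq κ] {p : M}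
    (e : OrthonormalBasis κ ℝ (TangentSpace (𝓡 (n + 2)) p))
    (v : TangentSpace (𝓡 (2 * m + 2)) (ι p)) (i j : κ) :
    LinearMap.toMatrix e.toBasis e.toBasis (shapeOperator (n + 2) (2 * m + 2) ι p v) i j =
      inner ℝ (secondFundamentalForm (n + 2) (2 * m + 2) ι p (e j) (e i)) v := by
  rw [LinearMap.toMatrix_apply, OrthonormalBasis.coe_toBasis_repr_apply,
    OrthonormalBasis.repr_apply_apply, OrthonormalBasis.coe_toBasis, real_inner_comm,
    inner_shapeOperator]

/-- The difference `τ - K(P)` in an orthonormal basis adapted to `P`. -/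
theorem scalarCurvature_sub_planeCurvature
    (hN : S.IsGeneralizedSSpaceForm F₁ F₂ F₃ F₁₁ F₁₂ F₂₁ F₂₂)
    (hι : IsIsometricImmersion (n + 2) (2 * m + 2) ι) (hξ : S.IsTangent n ι) (p : M)
    (P : Submodule ℝ (TangentSpace (𝓡 (n + 2)) p)) (hP : Module.finrank ℝ P = 2)
    (hPL : P ≤ S.distL n ι p)
    (e : OrthonormalBasis (Fin (n + 2)) ℝ (TangentSpace (𝓡 (n + 2)) p)) (h0 : e 0 ∈ P)
    (h1 : e 1 ∈ P) (s : Fin (n + 2) → Fin (n + 2) → TangentSpace (𝓡 (2 * m + 2)) (ι p))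
    (hs : ∀ i j, s i j = secondFundamentalForm (n + 2) (2 * m + 2) ι p (e i) (e j)) :
    scalarCurvature (n + 2) p - planeCurvature P hP =
      (n : ℝ) * ((n : ℝ) + 2) ^ 2 / (2 * ((n : ℝ) + 1)) *
          ‖meanCurvature (n + 2) (2 * m + 2) ι p‖ ^ 2
        + (n : ℝ) * ((n : ℝ) + 3) / 2 * F₁ (ι p) + F₃ (ι p)
        - ((n : ℝ) + 1) * (F₁₁ (ι p) + F₂₂ (ι p))
        + 3 * F₂ (ι p) * (S.normSqT n ι p / 2 - S.planeFSq ι P hP)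
      + (((1 / 2) * ∑ i, ∑ j, (inner ℝ (s i i) (s j j) - ‖s i j‖ ^ 2) -
        (inner ℝ (s 0 0) (s 1 1) - ‖s 0 1‖ ^ 2)) -
        (n / (2 * (n + 1)) : ℝ) * ‖∑ i, s i i‖ ^ 2) := by
  -- The trace of `σ` is `(n + 2) H` in any basis; this is the source of the factor `(n + 2) ^ 2`.
  have hH : ((n : ℝ) + 2) ^ 2 * ‖meanCurvature (n + 2) (2 * m + 2) ι p‖ ^ 2 =
      ‖∑ i, s i i‖ ^ 2 := by
    have hσ := sum_bilin_orthonormalBasis (stdOrthonormalBasis ℝ (TangentSpace (𝓡 (n + 2)) p)) e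
      (secondFundamentalFormₗ m n ι p)
    simp only [secondFundamentalFormₗ_apply, ← hs] at hσ
    rw [meanCurvature, hσ, norm_smul, mul_pow, Real.norm_eq_abs, sq_abs]
    have : (n : ℝ) + 2 ≠ 0 := by positivity
    push_cast
    field_simp
  have h01 : (0 : Fin (n + 2)) ≠ 1 := by simp
  -- Removing the plane lowers the coefficient of `F₁` by one: `(n + 2)(n + 1)/2 - 1 = n(n + 3)/2`.
  rw [scalarCurvature_eq hN hι hξ p e, planeCurvature_eq hN hι hξ p P hP hPL
    (e.orthonormal.1 0) (e.orthonormal.1 1) (e.orthonormal.2 h01) h0 h1, ← hH]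
  simp_rw [hs]
  ring

theorem exists_adapted_orthonormalBasis
    (hι : IsIsometricImmersion (n + 2) (2 * m + 2) ι) (hξ : S.IsTangent n ι) (p : M)
    (P : Submodule ℝ (TangentSpace (𝓡 (n + 2)) p)) (hP : Module.finrank ℝ P = 2)
    (hPL : P ≤ S.distL n ι p) :
    ∃ e : OrthonormalBasis (Fin (n + 2)) ℝ (TangentSpace (𝓡 (n + 2)) p),
      (∀ i : Fin (n + 2), i.val = n →
        mfderiv (𝓡 (n + 2)) (𝓡 (2 * m + 2)) ι p (e i) = S.ξ 0 (ι p)) ∧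
      (∀ i : Fin (n + 2), i.val = n + 1 →
        mfderiv (𝓡 (n + 2)) (𝓡 (2 * m + 2)) ι p (e i) = S.ξ 1 (ι p)) ∧
      Submodule.span ℝ {e 0, e 1} = P := by
  choose z hz using hξ p
  have hz (α : Fin 2) : mfderiv (𝓡 (n + 2)) (𝓡 (2 * m + 2)) ι p (z α) = S.ξ α (ι p) := hz α
  have hzo (α β : Fin 2) : inner ℝ (z α) (z β) = if α = β then (1 : ℝ) else 0 := by
    rw [← hι.inner_mfderiv, hz, hz, orthonormal_iff_ite.1 (S.orthonormal_ξ (ι p))]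
  have hzP (α : Fin 2) {X} (hX : X ∈ P) : inner ℝ (z α) X = 0 := by
    rw [← hι.inner_mfderiv, hz]
    exact (MetricFStructure.mem_distL_iff X).1 (hPL hX) α
  set q := planeBasis P hP with hq
  have hqo (i j : Fin 2) : inner ℝ (q i : TangentSpace (𝓡 (n + 2)) p) (q j) =
      if i = j then (1 : ℝ) else 0 := orthonormal_iff_ite.1 q.orthonormal i j
  let g : Fin 2 ⊕ Fin 2 → TangentSpace (𝓡 (n + 2)) p := Sum.elim (fun i ↦ q i) z
  have hg : Orthonormal ℝ g := by
    rw [orthonormal_iff_ite]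
    rintro (i | i) (j | j)
    · simpa [g] using hqo i j
    · simpa [g, real_inner_comm] using hzP j (q i).2
    · simpa [g] using hzP i (q j).2
    · simpa [g] using hzo i j
  -- Two vectors of `P` and two structure vectors are orthonormal in dimension `n + 2`. So the
  -- places `0, 1` and `n, n + 1` do not overlap.
  have hn : 2 ≤ n := by
    have := hg.linearIndependent.fintype_card_le_finrank
    rw [finrank_tangentSpace] at this
    simp at this
    omega
  let j : Fin 2 ⊕ Fin 2 → Fin (n + 2) :=
    Sum.elim (fun i ↦ ⟨i.val, by omega⟩) (fun i ↦ ⟨n + i.val, by omega⟩)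
  have hj : Function.Injective j := by
    rintro (a | a) (b | b) h <;> simp [j, Fin.ext_iff] at h ⊢ <;> omega
  obtain ⟨e, he⟩ := exists_orthonormalBasis_comp_eq (κ := Fin (n + 2))
    (by rw [finrank_tangentSpace, Fintype.card_fin]) hg hj
  have e0 : e 0 = q 0 := he (Sum.inl 0)
  have e1 : e 1 = q 1 := he (Sum.inl 1)
  refine ⟨e, fun i hi ↦ ?_, fun i hi ↦ ?_, ?_⟩
  · obtain rfl : i = j (Sum.inr 0) := Fin.ext hi
    exact (congrArg _ (he (Sum.inr 0))).trans (hz 0)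
  · obtain rfl : i = j (Sum.inr 1) := Fin.ext hi
    exact (congrArg _ (he (Sum.inr 1))).trans (hz 1)
  have hspan := congrArg (Submodule.map P.subtype) q.toBasis.span_eq
  rw [Submodule.map_span, Submodule.map_top, Submodule.range_subtype, ← Set.range_comp] at hspan
  rw [e0, e1]
  refine Eq.trans ?_ hspan
  congr 1
  ext X
  simp [Fin.exists_fin_two, eq_comm]

end Intrinsic

end SSpaceForm

end

/-! ### The inequality and its equality case. -/

open SSpaceForm in
theorem mainTheorem1 (m n : ℕ)
    {N : Type*} [TopologicalSpace N]
    [ChartedSpace (EuclideanSpace ℝ (Fin (2 * m + 2))) N] [IsManifold (𝓡 (2 * m + 2)) ∞ N]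
    [RiemannianBundle (fun x : N ↦ TangentSpace (𝓡 (2 * m + 2)) x)]
    [IsContMDiffRiemannianBundle (𝓡 (2 * m + 2)) ∞ (EuclideanSpace ℝ (Fin (2 * m + 2)))
      (fun x : N ↦ TangentSpace (𝓡 (2 * m + 2)) x)]
    (S : SSpaceForm.MetricFStructure m 2 N) (F₁ F₂ F₃ F₁₁ F₁₂ F₂₁ F₂₂ : N → ℝ)
    (hN : S.IsGeneralizedSSpaceForm F₁ F₂ F₃ F₁₁ F₁₂ F₂₁ F₂₂)
    {M : Type*} [TopologicalSpace M]
    [ChartedSpace (EuclideanSpace ℝ (Fin (n + 2))) M] [IsManifold (𝓡 (n + 2)) ∞ M]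
    [RiemannianBundle (fun x : M ↦ TangentSpace (𝓡 (n + 2)) x)]
    [IsContMDiffRiemannianBundle (𝓡 (n + 2)) ∞ (EuclideanSpace ℝ (Fin (n + 2)))
      (fun x : M ↦ TangentSpace (𝓡 (n + 2)) x)]
    (ι : M → N) (hι : SSpaceForm.IsIsometricImmersion (n + 2) (2 * m + 2) ι)
    (hξ : S.IsTangent n ι)
    (p : M) (P : Submodule ℝ (TangentSpace (𝓡 (n + 2)) p))
    (hP : Module.finrank ℝ P = 2) (hPL : P ≤ S.distL n ι p) :
    SSpaceForm.scalarCurvature (n + 2) p - SSpaceForm.planeCurvature P hP ≤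
        (n : ℝ) * ((n : ℝ) + 2) ^ 2 / (2 * ((n : ℝ) + 1)) *
            ‖SSpaceForm.meanCurvature (n + 2) (2 * m + 2) ι p‖ ^ 2
          + (n : ℝ) * ((n : ℝ) + 3) / 2 * F₁ (ι p) + F₃ (ι p)
          - ((n : ℝ) + 1) * (F₁₁ (ι p) + F₂₂ (ι p))
          + 3 * F₂ (ι p) * (S.normSqT n ι p / 2 - S.planeFSq ι P hP)
    ∧ (SSpaceForm.scalarCurvature (n + 2) p - SSpaceForm.planeCurvature P hP =
          (n : ℝ) * ((n : ℝ) + 2) ^ 2 / (2 * ((n : ℝ) + 1)) *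
              ‖SSpaceForm.meanCurvature (n + 2) (2 * m + 2) ι p‖ ^ 2
            + (n : ℝ) * ((n : ℝ) + 3) / 2 * F₁ (ι p) + F₃ (ι p)
            - ((n : ℝ) + 1) * (F₁₁ (ι p) + F₂₂ (ι p))
            + 3 * F₂ (ι p) * (S.normSqT n ι p / 2 - S.planeFSq ι P hP)
        ↔ ∃ (e : OrthonormalBasis (Fin (n + 2)) ℝ (TangentSpace (𝓡 (n + 2)) p))
            (ν : OrthonormalBasis (Fin (2 * m - n)) ℝ
              (SSpaceForm.normalSpace (n + 2) (2 * m + 2) ι p)),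
            mfderiv (𝓡 (n + 2)) (𝓡 (2 * m + 2)) ι p (e ⟨n, by omega⟩) = S.ξ 0 (ι p) ∧
            mfderiv (𝓡 (n + 2)) (𝓡 (2 * m + 2)) ι p (e ⟨n + 1, by omega⟩) = S.ξ 1 (ι p) ∧
            Submodule.span ℝ {e 0, e 1} = P ∧
            (∃ a b c : ℝ, ∀ r : Fin (2 * m - n), r.val = 0 →
              LinearMap.toMatrix e.toBasis e.toBasis
                (SSpaceForm.shapeOperator (n + 2) (2 * m + 2) ι p (ν r)) =
                  SSpaceForm.firstShapeMatrix (n + 2) a b c) ∧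
            (∃ a b : Fin (2 * m - n) → ℝ, ∀ r : Fin (2 * m - n), r.val ≠ 0 →
              LinearMap.toMatrix e.toBasis e.toBasis
                (SSpaceForm.shapeOperator (n + 2) (2 * m + 2) ι p (ν r)) =
                  SSpaceForm.otherShapeMatrix (n + 2) (a r) (b r))) := by
  obtain ⟨e, hen, hen', heP⟩ := exists_adapted_orthonormalBasis hι hξ p P hP hPL
  have hmem (e : OrthonormalBasis (Fin (n + 2)) ℝ (TangentSpace (𝓡 (n + 2)) p))
      (he : Submodule.span ℝ {e 0, e 1} = P) : e 0 ∈ P ∧ e 1 ∈ P := by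
    rw [← he]
    exact ⟨Submodule.subset_span (by simp), Submodule.subset_span (by simp)⟩
  have hcomm (e : OrthonormalBasis (Fin (n + 2)) ℝ (TangentSpace (𝓡 (n + 2)) p))
      (i j : Fin (n + 2)) : secondFundamentalForm (n + 2) (2 * m + 2) ι p (e i) (e j) =
      secondFundamentalForm (n + 2) (2 * m + 2) ι p (e j) (e i) :=
    secondFundamentalForm_comm hι p _ _
  -- Stated for every basis adapted to `P`: the basis constructed above serves the inequality and
  -- one implication, a given one the converse.
  have key (e : OrthonormalBasis (Fin (n + 2)) ℝ (TangentSpace (𝓡 (n + 2)) p))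
      (he : Submodule.span ℝ {e 0, e 1} = P) :=
    scalarCurvature_sub_planeCurvature hN hι hξ p P hP hPL e (hmem e he).1 (hmem e he).2 _
      (fun _ _ ↦ rfl)
  constructor
  · have h := chen_le _ (hcomm e)
    rw [key e heP]
    linarith
  constructor
  · intro heq
    rw [key e heP, add_eq_left, sub_eq_zero, chen_eq_iff _ (hcomm e)] at heq
    -- The first normal vector is taken parallel to `σ(e 0, e 0) + σ(e 1, e 1)`, which forces `c =
    -- 0` in the other directions.
    obtain ⟨ν, hν⟩ := exists_orthonormalBasis_inner_eq_zero (finrank_normalSpace hι p)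
      (⟨_, Submodule.add_mem _ (secondFundamentalForm_mem_normalSpace hι p (e 0) (e 0))
        (secondFundamentalForm_mem_normalSpace hι p (e 1) (e 1))⟩ :
        normalSpace (n + 2) (2 * m + 2) ι p)
    have hmat (r : Fin (2 * m - n)) : ∃ a b c : ℝ,
        LinearMap.toMatrix e.toBasis e.toBasis (shapeOperator (n + 2) (2 * m + 2) ι p (ν r)) =
          firstShapeMatrix (n + 2) a b c ∧ (r.val ≠ 0 → c = 0) :=
      ⟨_, _, _, Matrix.ext fun i j ↦ (toMatrix_shapeOperator (m := m) (ι := ι) e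
        (ν r : TangentSpace (𝓡 (2 * m + 2)) (ι p)) i j).trans
          (heq.inner_eq_firstShapeMatrix (hcomm e) _ i j), fun hr ↦ hν r hr⟩
    choose a b c hmat hc using hmat
    refine ⟨e, ν, hen _ rfl, hen' _ rfl, heP, ?_, a, b, fun r hr ↦ ?_⟩
    · by_cases hk : 0 < 2 * m - n
      · refine ⟨a ⟨0, hk⟩, b ⟨0, hk⟩, c ⟨0, hk⟩, fun r hr ↦ ?_⟩
        obtain rfl : r = ⟨0, hk⟩ := Fin.ext hr
        exact hmat _
      -- The normal space is zero and the condition is void.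
      · exact ⟨0, 0, 0, fun r ↦ absurd r.pos hk⟩
    · rw [otherShapeMatrix_eq_firstShapeMatrix, hmat, hc r hr]
  · rintro ⟨e, ν, -, -, heP, ⟨a, b, c, h1⟩, ⟨a', b', h2⟩⟩
    rw [key e heP, add_eq_left, sub_eq_zero, chen_eq_iff _ (hcomm e)]
    refine isChenIdeal_of_inner_eq_firstShapeMatrix
      (fun i j ↦ secondFundamentalForm_mem_normalSpace hι p (e i) (e j)) ν fun r ↦ ?_
    by_cases hr : r.val = 0
    · refine ⟨a, b, c, fun i j ↦ ?_⟩
      rw [← toMatrix_shapeOperator, h1 r hr]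
    · refine ⟨a' r, b' r, 0, fun i j ↦ ?_⟩
      rw [← toMatrix_shapeOperator, h2 r hr, otherShapeMatrix_eq_firstShapeMatrix]
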